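/- **Setting.** For each $n\ge 1$ let $H=H(n)$ be an $n\times n$ Hermitian matrix, $\beta=\beta(n)>0$ and $\sigma=\sigma(n)>0$ with $\sigma=\Theta(\beta^{-1})$ as $n\to\infty$. Put $$f(t)=e^{-\sigma^2t^2}\sqrt{\sigma\sqrt{2/\pi}},\quad \hat f(\omega)=\frac{e^{-\omega^2/(4\sigma^2)}}{\sqrt{\sigma\sqrt{2\pi}}},\quad \gamma(\omega)=e^{-\beta\max(\omega+\beta\sigma^2/2,\,0)},$$ $$\theta(\nu_1,\nu_2)=\int_{\mathbb R}\hat f(\omega-\nu_1)\hat f(\omega-\nu_2)\gamma(\omega)\,d\omega,\qquad \alpha(\nu)=\theta(\nu,\nu).$$ For a matrix $A$ let $\hat A(\omega)=\frac1{\sqrt{2\pi}}\int_{\mathbb R} e^{iHt}Ae^{-iHt}e^{-i\omega t}f(t)\,dt$, and let $A_\nu=\sum_{E_l-E_m=\nu}|l\rangle\langle l|A|m\rangle\langle m|$, where $|j\rangle$ is an orthonormal eigenbasis of $H$ with energies $E_j$. The CKG Lindbladian with jump operators $(A^a)_a$ is $$\mathcal L_\beta[N]=-i[B,N]+\sum_a\int_{\mathbb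 R}\gamma(\omega)\Big(\hat A^a(\omega)N\hat A^a(\omega)^\dagger-\tfrac12\{\hat A^a(\omega)^\dagger\hat A^a(\omega),N\}\Big)d\omega,$$ $$B=\sum_a\sum_{\nu_1,\nu_2}\frac{\tanh(-\beta(\nu_1-\nu_2)/4)}{2i}\,\theta(\nu_1,\nu_2)\,(A^a_{\nu_2})^\dagger A^a_{\nu_1}.$$ Let $\mathcal D=\mathcal D(n)$ be a unitary $1$-design, that is, a Borel probability measure on $U(n)$ with $\mathbb E_{V\sim\mathcal D}[VXV^\dagger]=\mathbb E_{V\sim\mathrm{Haar}}[VXV^\dagger]$ for all matrices $X$ (for instance the Haar measure itself). Let $\mathcal L_\mu=\mathbb E_{V\sim\mathcal D}[\mathcal L_\beta]$, where $\mathcal L_\beta$ has the single jump operator $V$. The spectral gap $\lambda_{\rm gap}$ of a generator is the least modulus of its eigenvalues, counted with algebraic multiplicity, after one eigenvalue $0$ has been removed. **Lemma.** 1. The expectation $\mathcal L_\mu$ exists. For every orthonormal eigenbasis $(|j\rangle)$ of $H$ with energies $(E_j)$, $\mathcal L_\mu=\mathcal L_{\rm classical}+\mathcal L_{\rm dephasing}$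 with $$\mathcal L_{\rm classical}[N]=\sum_{l,m}Q_{lm}\langle m|N|m\rangle\,|l\rangle\langle l|,\qquad \mathcal L_{\rm dephasing}[N]=-\sum_{l\ne m}\kappa_{lm}\langle l|N|m\rangle\,|l\rangle\langle m|,$$ $$Q_{lm}=\tfrac1n\alpha(E_l-E_m)\ (l\neq m),\quad Q_{mm}=-\sum_{j\ne m}Q_{jm},\quad \kappa_{lm}=\tfrac1{2n}\sum_j\big(\alpha(E_j-E_l)+\alpha(E_j-E_m)\big).$$ Here $Q$ is the generator of a continuous-time Markov chain with strictly positive jump rates ($Q_{lm}$ is the rate of $m\to l$), reversible with respect to the Gibbs distribution $e^{-\beta E_m}/\sum_je^{-\beta E_j}$; the rates $\kappa_{lm}$ ($l\ne m$) are strictly positive; and for $n\ge2$, $\lambda_{\rm gap}(\mathcal L_\mu)=\min\big(\lambda_{\rm gap}(Q),\min_{l\ne m}\kappa_{lm}\big)$. 2. Fix a constant $C$ and let $\delta(n)$ be the proportion of eigenvalues $\lambda_j$ of $H(n)$ (with multiplicity) such that $\beta(n)(\lambda_j-\lambda_{\min})\le C$. Then $\lambda_{\rm gap}(\mathcal L_\mu)=\Omega(\delta(n))$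 as $n\to\infty$. 3. If $\beta(n)\|H(n)\|=O(1)$ (operator norm), then $\lambda_{\rm gap}(\mathcal L_\mu)=\Omega(1)$. -/

import Mathlib

open Filter Asymptotics MeasureTheory
open scoped Matrix Matrix.Norms.L2Operator

/-! Matrices carry the operator norm of `ℂⁿ` with its Euclidean norm (scope
`Matrix.Norms.L2Operator`), so superoperators are continuous linear maps
`Matrix →L[ℂ] Matrix` and expectations of superoperators are Bochner integrals. -/

noncomputable section

namespace CKG

/-- Complex `n × n` matrices. -/
abbrev Mat (n : ℕ) : Type := Matrix (Fin n) (Fin n) ℂ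

/-- The unitary group `U(n)`. -/
abbrev U (n : ℕ) : Type := Matrix.unitaryGroup (Fin n) ℂ

/-- Linear maps on `n × n` matrices. -/
abbrev Superop (n : ℕ) : Type := Mat n →L[ℂ] Mat n

variable {n : ℕ}

/-! ### Haar measure and unitary 1-designs -/

/-- `U(n)` carries its Borel `σ`-algebra. -/
instance instMeasurableSpaceU (n : ℕ) : MeasurableSpace (U n) := borel _

instance instBorelSpaceU (n : ℕ) : BorelSpace (U n) := ⟨rfl⟩

instance instCompactSpaceU (n : ℕ) : CompactSpace (U n) := by
  suffices hc : IsCompact {A : Mat n | A ∈ Matrix.unitaryGroup (Fin n) ℂ} from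
    isCompact_iff_compactSpace.mp hc
  have : ProperSpace (Mat n) := FiniteDimensional.proper ℂ _
  apply Metric.isCompact_of_isClosed_isBounded
  · have h : {A : Mat n | A ∈ Matrix.unitaryGroup (Fin n) ℂ}
        = {A : Mat n | A * star A = 1} := by
      ext A
      exact Matrix.mem_unitaryGroup_iff
    rw [h]
    exact isClosed_eq (by fun_prop) continuous_const
  · refine isBounded_iff_forall_norm_le.mpr ⟨1, fun A hA => ?_⟩
    by_cases hn : Nonempty (Fin n)
    · exact (CStarRing.norm_of_mem_unitary (U := A) hA).le
    · have : IsEmpty (Fin n) := not_nonempty_iff.mp hn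
      have : A = 0 := Subsingleton.elim _ _
      simp [this]

/-- The Haar probability measure on `U(n)`. -/
def haarU (n : ℕ) : Measure (U n) := Measure.haarMeasure ⊤

instance instIsProbabilityMeasureHaarU (n : ℕ) : IsProbabilityMeasure (haarU n) :=
  ⟨by simpa [haarU] using Measure.haarMeasure_self (K₀ := (⊤ : TopologicalSpace.PositiveCompacts (U n)))⟩

/-- A probability distribution on `U(n)` is a unitary 1-design if it reproduces the Haar average
of every `X ↦ V X V†`. -/
def IsUnitaryOneDesign (D : Measure (U n)) : Prop :=
  ∀ X : Mat n, ∫ V : U n, (V : Mat n) * X * (V : Mat n)ᴴ ∂D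
    = ∫ V : U n, (V : Mat n) * X * (V : Mat n)ᴴ ∂(haarU n)

theorem isUnitaryOneDesign_haarU (n : ℕ) : IsUnitaryOneDesign (haarU n) := fun _ => rfl

/-! ### Filters -/

/-- The Gaussian window `f(t) = e^{-σ² t²} √(σ √(2/π))`. -/
def window (σ t : ℝ) : ℝ :=
  Real.exp (-(σ ^ 2 * t ^ 2)) * Real.sqrt (σ * Real.sqrt (2 / Real.pi))

/-- Its Fourier transform `f̂(ω) = exp(-ω² / (4σ²)) / √(σ √(2π))`. -/
def windowHat (σ ω : ℝ) : ℝ :=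
  1 / Real.sqrt (σ * Real.sqrt (2 * Real.pi)) * Real.exp (-(ω ^ 2 / (4 * σ ^ 2)))

/-- The shifted Metropolis filter `γ(ω) = exp(-β max(ω + βσ²/2, 0))`. -/
def gam (β σ ω : ℝ) : ℝ := Real.exp (-(β * max (ω + β * σ ^ 2 / 2) 0))

/-- `θ(ν₁, ν₂) = ∫ f̂(ω - ν₁) f̂(ω - ν₂) γ(ω) dω`. -/
def theta (β σ ν₁ ν₂ : ℝ) : ℝ :=
  ∫ ω : ℝ, windowHat σ (ω - ν₁) * windowHat σ (ω - ν₂) * gam β σ ω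

/-- `α(ν) = θ(ν, ν)`. -/
def alpha (β σ ν : ℝ) : ℝ := theta β σ ν ν

/-! ### The CKG Lindbladian -/

/-- The superoperator `N ↦ X N Y`. -/
def sandwich (X Y : Mat n) : Superop n := ContinuousLinearMap.mulLeftRight ℂ (Mat n) X Y

theorem sandwich_apply (X Y N : Mat n) : sandwich X Y N = X * N * Y := by
  simp [sandwich]

/-- The superoperator `N ↦ {X, N} = X N + N X`. -/
def anticomm (X : Mat n) : Superop n := sandwich X 1 + sandwich 1 X

/-- The superoperator `N ↦ [X, N] = X N - N X`. -/
def comm (X : Mat n) : Superop n := sandwich X 1 - sandwich 1 X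

/-- The operator Fourier transform
`Â(ω) = (2π)^{-1/2} ∫ e^{iHt} A e^{-iHt} e^{-iωt} f(t) dt`. -/
def oft (H : Mat n) (σ : ℝ) (A : Mat n) (ω : ℝ) : Mat n :=
  ((1 / Real.sqrt (2 * Real.pi) : ℝ) : ℂ) •
    ∫ t : ℝ, (Complex.exp (-(Complex.I * ω * t)) * (window σ t : ℂ)) •
      (NormedSpace.exp ((Complex.I * t) • H) * A * NormedSpace.exp (-((Complex.I * t) • H)))

/-- `|x⟩⟨y|` for two vectors. -/
def ketbra (x y : EuclideanSpace ℂ (Fin n)) : Mat n :=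
  Matrix.vecMulVec x.ofLp (star y.ofLp)

/-- The set of Bohr frequencies `E_l - E_m` of `H`. -/
def bohrFrequencies {H : Mat n} (hH : H.IsHermitian) : Finset ℝ :=
  Finset.image (fun p : Fin n × Fin n => hH.eigenvalues p.1 - hH.eigenvalues p.2) Finset.univ

/-- `A_ν = ∑_{E_l - E_m = ν} |l⟩⟨l| A |m⟩⟨m|`, the part of `A` with Bohr frequency `ν`. -/
def bohrComponent {H : Mat n} (hH : H.IsHermitian) (A : Mat n) (ν : ℝ) : Mat n :=
  ∑ l : Fin n, ∑ m : Fin n,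
    if hH.eigenvalues l - hH.eigenvalues m = ν then
      ketbra (hH.eigenvectorBasis l) (hH.eigenvectorBasis l) * A *
        ketbra (hH.eigenvectorBasis m) (hH.eigenvectorBasis m)
    else 0

/-- The Hamiltonian of the coherent term,
`B = ∑_a ∑_{ν₁,ν₂} tanh(-β(ν₁-ν₂)/4) / (2i) · θ(ν₁,ν₂) (A^a_{ν₂})† A^a_{ν₁}`. -/
def coherentB {ι : Type*} [Fintype ι] {H : Mat n} (hH : H.IsHermitian) (β σ : ℝ)
    (A : ι → Mat n) : Mat n :=
  ∑ a : ι, ∑ ν₁ ∈ bohrFrequencies hH, ∑ ν₂ ∈ bohrFrequencies hH,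
    (((Real.tanh (-(β * (ν₁ - ν₂)) / 4) * theta β σ ν₁ ν₂ : ℝ) : ℂ) / (2 * Complex.I)) •
      ((bohrComponent hH (A a) ν₂)ᴴ * bohrComponent hH (A a) ν₁)

/-- The CKG Lindbladian with Hamiltonian `H`, inverse temperature `β`, energy resolution `σ` and
jump operators `A`:
`L[N] = -i[B, N] + ∑_a ∫ γ(ω) (Â^a(ω) N Â^a(ω)† - ½ {Â^a(ω)† Â^a(ω), N}) dω`. -/
def lindbladian {ι : Type*} [Fintype ι] {H : Mat n} (hH : H.IsHermitian) (β σ : ℝ)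
    (A : ι → Mat n) : Superop n :=
  (-Complex.I) • comm (coherentB hH β σ A) +
    ∑ a : ι, ∫ ω : ℝ, (gam β σ ω : ℂ) •
      (sandwich (oft H σ (A a) ω) (oft H σ (A a) ω)ᴴ
        - (1 / 2 : ℂ) • anticomm ((oft H σ (A a) ω)ᴴ * oft H σ (A a) ω))

/-- The CKG Lindbladian with the single unitary jump operator `V`. -/
def jumpLindbladian {H : Mat n} (hH : H.IsHermitian) (β σ : ℝ) (V : U n) : Superop n :=
  lindbladian hH β σ (fun _ : Unit => (V : Mat n))

/-- The expected CKG Lindbladian over one jump operator drawn from `D`. -/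
def averageLindbladian {H : Mat n} (hH : H.IsHermitian) (β σ : ℝ) (D : Measure (U n)) :
    Superop n :=
  ∫ V : U n, jumpLindbladian hH β σ V ∂D

/-! ### Spectral quantities -/

/-- The spectral gap of a generator: the least modulus of its eigenvalues, listed with algebraic
multiplicity, after one copy of the eigenvalue `0` has been removed. It is `0` when the eigenvalue
`0` is degenerate. -/
def spectralGap {V : Type*} [AddCommGroup V] [Module ℂ V] [FiniteDimensional ℂ V]
    (T : V →ₗ[ℂ] V) : ℝ :=
  sInf {r : ℝ | ∃ z ∈ T.charpoly.roots.erase 0, r = ‖z‖}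

/-- The proportion of eigenvalues `λ_j` of `H`, with multiplicity, such that
`β (λ_j - λ_min) ≤ C`. -/
def lowEnergyFraction {H : Mat n} (hH : H.IsHermitian) (β C : ℝ) : ℝ :=
  (Nat.card {j : Fin n // β * (hH.eigenvalues j - ⨅ k, hH.eigenvalues k) ≤ C} : ℝ) / n

/-! ### The classical and dephasing parts

Here `v` is an orthonormal basis of energy eigenvectors and `E` lists their energies. -/

/-- The transition-rate matrix of the classical chain: the rate of the jump `m → l`, `l ≠ m`, is
`α(E_l - E_m) / n`, and each column sums to zero. It acts on column vectors of populations. -/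
def classicalGenerator (β σ : ℝ) (E : Fin n → ℝ) : Matrix (Fin n) (Fin n) ℝ :=
  Matrix.of fun l m =>
    if l = m then -∑ j ∈ Finset.univ.erase m, alpha β σ (E j - E m) / n
    else alpha β σ (E l - E m) / n

/-- The decay rate `(1/2n) ∑_j (α(E_j - E_l) + α(E_j - E_m))` of the coherence `|l⟩⟨m|`. -/
def dephasingRate (β σ : ℝ) (E : Fin n → ℝ) (l m : Fin n) : ℝ :=
  1 / (2 * n) * ∑ j, (alpha β σ (E j - E l) + alpha β σ (E j - E m))

/-- The Gibbs probability `e^{-β E_m} / ∑_j e^{-β E_j}`. -/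
def gibbs (β : ℝ) (E : Fin n → ℝ) (m : Fin n) : ℝ :=
  Real.exp (-(β * E m)) / ∑ j, Real.exp (-(β * E j))

/-- `N ↦ ∑_{l,m} Q_{lm} ⟨m|N|m⟩ |l⟩⟨l|` for the classical rate matrix `Q`. -/
def classicalPart (β σ : ℝ) (E : Fin n → ℝ)
    (v : OrthonormalBasis (Fin n) ℂ (EuclideanSpace ℂ (Fin n))) : Superop n :=
  ∑ l, ∑ m, (classicalGenerator β σ E l m : ℂ) • sandwich (ketbra (v l) (v m)) (ketbra (v m) (v l))

/-- `N ↦ -∑_{l ≠ m} κ_{lm} ⟨l|N|m⟩ |l⟩⟨m|` for the dephasing rates `κ`. -/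
def dephasingPart (β σ : ℝ) (E : Fin n → ℝ)
    (v : OrthonormalBasis (Fin n) ℂ (EuclideanSpace ℂ (Fin n))) : Superop n :=
  -∑ l, ∑ m ∈ Finset.univ.erase l,
    (dephasingRate β σ E l m : ℂ) • sandwich (ketbra (v l) (v l)) (ketbra (v m) (v m))

end CKG

end

/-! ### Spectra of Markov generators -/

section MarkovGenerator

variable {ι : Type*} [Fintype ι] [DecidableEq ι]

/-! A unitary 1-design enters only through first moments: `𝔼[V X V†] = (tr X / n) 1`, equivalently
`𝔼[V_{ij} conj V_{kl}] = δ_{ik} δ_{jl} / n`. In an energy eigenbasis the operator Fourier transform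
multiplies the transition component `|l⟩⟨l|V|m⟩⟨m|` by `f̂(ω - (E_l - E_m))`. The dissipator is
therefore a finite double sum over transitions `p`, `q`, weighted by `θ(ν_p, ν_q)`, and averaging
keeps only `p = q`, with weight `α(ν_p) / n`. The coherent term averages to zero: distinct Bohr
frequencies share no transition, and for equal ones the `tanh` vanishes.

What remains does not mix populations with coherences. On populations it is the generator `Q`, and
on coherences it is diagonal with entries `-κ_{lm}`. The characteristic polynomial factors, so the
gap is the smaller of the two gaps. Detailed balance for `Q` comes from the symmetry of `α`, a
Gaussian average of the shifted Metropolis filter.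

For the lower bound, `α(ν) ≥ γ(ν) / 2`, because half of the Gaussian mass of `f̂²` lies below the
mean and `γ` decreases. Hence every low-energy state is entered from every other state at rate at
least `c / n`, with `c` depending only on `C` and a bound on `βσ`. The Doeblin bound (a rank-one
shift followed by Gershgorin discs) turns this into a gap of at least `c δ` for `Q`. The same
estimate, summed over the low-energy states, gives `κ_{lm} ≥ c δ`. -/

open Polynomial in
/-- If the columns of `A` sum to zero, subtracting `u` from every column of `A` moves one root of
the characteristic polynomial from `0` to `-∑ i, u i`. -/
theorem Matrix.X_mul_charpoly_sub_vecMulVec_one {K : Type*} [Field K] (A : Matrix ι ι K)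
    (u : ι → K) (hA : ∀ m, ∑ l, A l m = 0) :
    X * (A - vecMulVec u 1).charpoly = (X + C (∑ i, u i)) * A.charpoly := by
  cases isEmpty_or_nonempty ι
  · simp [Matrix.charpoly]
  -- Zero column sums give `1ᵀ(X - A) = X 1ᵀ`, so `(X + u 1ᵀ)(X - A) = X (X - A + u 1ᵀ)`. Taking
  -- determinants proves the identity up to a power of `X`.
  have hmul : (X : K[X]) • (A - vecMulVec u 1).charmatrix
      = (-vecMulVec u 1).charmatrix * A.charmatrix := by
    ext i j
    have h1 : ∑ k, A.charmatrix k j = X := by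
      simp [charmatrix_apply, Finset.sum_sub_distrib, diagonal_apply, ← map_sum, hA]
    have h2 : ∑ k, C (u i) * A.charmatrix k j = C (u i) * X := by rw [← Finset.mul_sum, h1]
    simp only [smul_apply, mul_apply, charmatrix_apply (-vecMulVec u 1), diagonal_apply,
      neg_apply, vecMulVec_apply, Pi.one_apply, mul_one, map_neg, sub_neg_eq_add, add_mul,
      Finset.sum_add_distrib, h2, ite_mul, zero_mul, Finset.sum_ite_eq, Finset.mem_univ, if_true,
      smul_eq_mul]
    simp only [charmatrix_apply, sub_apply, vecMulVec_apply, Pi.one_apply, mul_one, map_sub]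
    ring_nf
  have hdet := congrArg det hmul
  rw [det_smul, det_mul] at hdet
  change X ^ _ * (A - vecMulVec u 1).charpoly = (-vecMulVec u 1).charpoly * A.charpoly at hdet
  have hrank : (-vecMulVec u (1 : ι → K)).charpoly
      = X ^ (Fintype.card ι - 1) * (X + C (∑ i, u i)) := by
    have := charpoly_vecMulVec (-u) (1 : ι → K)
    rw [neg_vecMulVec] at this
    rw [this]
    have hc : Fintype.card ι = Fintype.card ι - 1 + 1 := by
      have := Fintype.card_pos (α := ι); omega
    nth_rw 1 [hc]
    simp [dotProduct, smul_eq_C_mul]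
    ring_nf
  have hc : Fintype.card ι = Fintype.card ι - 1 + 1 := by
    have := Fintype.card_pos (α := ι); omega
  rw [hrank] at hdet
  nth_rw 1 [hc] at hdet
  rw [pow_succ, mul_assoc, mul_assoc] at hdet
  exact mul_left_cancel₀ (pow_ne_zero _ X_ne_zero) hdet

open Polynomial in
theorem Matrix.zero_mem_roots_charpoly_of_sum_eq_zero [Nonempty ι] {K : Type*} [Field K]
    (A : Matrix ι ι K) (hA : ∀ m, ∑ l, A l m = 0) : 0 ∈ A.charpoly.roots := by
  rw [mem_roots A.charpoly_monic.ne_zero, IsRoot, Matrix.eval_charpoly]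
  have : (1 : ι → K) ᵥ* (scalar ι 0 - A) = 0 := by
    ext m
    simp [vecMul, dotProduct, hA]
  exact exists_vecMul_eq_zero_iff.mp ⟨1, one_ne_zero, this⟩

open Polynomial in
/-- **Doeblin bound.** If a Markov generator jumps into each state `l` at rate at least `u l` from
everywhere, then its eigenvalues other than one copy of `0` have modulus at least `∑ i, u i`. -/
theorem Matrix.sum_le_norm_of_mem_roots_charpoly_erase (Q : Matrix ι ι ℝ) (u : ι → ℝ)
    (hQ : ∀ m, ∑ l, Q l m = 0) (hu : ∀ l m, l ≠ m → u l ≤ Q l m) {z : ℂ}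
    (hz : z ∈ (Q.map ((↑) : ℝ → ℂ)).charpoly.roots.erase 0) : ∑ i, u i ≤ ‖z‖ := by
  rcases le_or_gt (∑ i, u i) 0 with h0 | h0
  · exact h0.trans (norm_nonneg _)
  set A : Matrix ι ι ℂ := Q.map ((↑) : ℝ → ℂ) with hAdef
  set w : ι → ℂ := fun i => (u i : ℂ) with hw
  have hA : ∀ m, ∑ l, A l m = 0 := fun m => by
    have := congrArg ((↑) : ℝ → ℂ) (hQ m)
    simpa [hAdef] using this
  cases isEmpty_or_nonempty ι
  · simp at h0
  have h := A.X_mul_charpoly_sub_vecMulVec_one w hA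
  -- The rank-one shift replaces one root `0` by `-∑ u` and leaves all the others, so `z` survives
  -- it.
  have hmem : z ∈ (A - vecMulVec w 1).charpoly.roots := by
    have hr := congrArg roots h
    rw [roots_mul (mul_ne_zero X_ne_zero (charpoly_monic _).ne_zero),
      roots_mul (mul_ne_zero (X_add_C_ne_zero _) (charpoly_monic _).ne_zero), roots_X,
      roots_X_add_C, Multiset.singleton_add, Multiset.singleton_add,
      ← Multiset.cons_erase (A.zero_mem_roots_charpoly_of_sum_eq_zero hA),
      Multiset.cons_swap, Multiset.cons_inj_right] at hr
    rw [hr]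
    exact Multiset.mem_cons_of_mem hz
  rw [← charpoly_transpose, ← charpoly_toLin', mem_roots (LinearMap.charpoly_monic _).ne_zero,
    ← Module.End.hasEigenvalue_iff_isRoot_charpoly] at hmem
  -- Gershgorin by columns. Off the diagonal the shifted matrix is still nonnegative, so the disc
  -- has centre `Q k k - u k` and radius `-Q k k - (∑ u - u k)`. It lies in `Re z ≤ -∑ u`.
  obtain ⟨k, hk⟩ := eigenvalue_mem_ball hmem
  have hrad : ∑ j ∈ Finset.univ.erase k, ‖(A - vecMulVec w 1)ᵀ k j‖
      = -Q k k - (∑ i, u i - u k) := by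
    have h1 : ∀ j ∈ Finset.univ.erase k, ‖(A - vecMulVec w 1)ᵀ k j‖ = Q j k - u j := by
      intro j hj
      have : (A - vecMulVec w 1)ᵀ k j = ((Q j k - u j : ℝ) : ℂ) := by
        simp [hAdef, hw]
      rw [this, Complex.norm_real, Real.norm_of_nonneg]
      exact sub_nonneg.mpr (hu j k (Finset.ne_of_mem_erase hj))
    rw [Finset.sum_congr rfl h1, Finset.sum_sub_distrib,
      Finset.sum_erase_eq_sub (Finset.mem_univ k), Finset.sum_erase_eq_sub (Finset.mem_univ k), hQ,
      zero_sub]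
  have hdiag : (A - vecMulVec w 1)ᵀ k k = ((Q k k - u k : ℝ) : ℂ) := by
    simp [hAdef, hw]
  rw [mem_closedBall_iff_norm, hrad, hdiag] at hk
  have hre := (Complex.re_le_norm _).trans hk
  have habs := (neg_le_abs _).trans (Complex.abs_re_le_norm z)
  simp only [Complex.sub_re, Complex.ofReal_re] at hre
  linarith

end MarkovGenerator
namespace CKG

variable {n : ℕ}

/-! ### First moments of unitary 1-designs -/

theorem continuous_coe_unitary : Continuous fun V : U n => (V : Mat n) := continuous_subtype_val

/-- Continuous functions on the compact group `U(n)` are integrable. -/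
theorem integrable_of_continuous {E : Type*} [NormedAddCommGroup E] (D : Measure (U n))
    [IsProbabilityMeasure D] {F : U n → E} (hF : Continuous F) : Integrable F D :=
  hF.integrable_of_hasCompactSupport (HasCompactSupport.of_compactSpace F)

/-- Unitaries span the whole matrix algebra, so `T` is central. -/
theorem exists_smul_one_of_commute_unitary (T : Mat n) (hT : ∀ W : U n, (W : Mat n) * T = T * W) :
    ∃ c : ℂ, T = c • 1 := by
  have hall : ∀ X : Mat n, Commute X T := fun X => by
    have hX : X ∈ Submodule.span ℂ (unitary (Mat n) : Set (Mat n)) := by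
      rw [CStarAlgebra.span_unitary]; trivial
    induction hX using Submodule.span_induction with
    | mem W hW => exact hT ⟨W, hW⟩
    | zero => exact Commute.zero_left T
    | add _ _ _ _ h₁ h₂ => exact h₁.add_left h₂
    | smul c _ _ h => exact h.smul_left c
  obtain ⟨c, rfl⟩ := Matrix.mem_range_scalar_of_commute_single (M := T) fun i j _ => hall _
  exact ⟨c, by simp [Matrix.smul_one_eq_diagonal]⟩

/-- By left invariance the average commutes with every unitary, hence is scalar. Conjugation
preserves the trace, which fixes the scalar. -/
theorem integral_haarU_conj (X : Mat n) :
    ∫ V : U n, (V : Mat n) * X * (V : Mat n)ᴴ ∂(haarU n) = (X.trace / n) • (1 : Mat n) := by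
  have hinv : (haarU n).IsMulLeftInvariant := by unfold haarU; infer_instance
  have hint : Integrable (fun V : U n => (V : Mat n) * X * (V : Mat n)ᴴ) (haarU n) :=
    integrable_of_continuous _ (by fun_prop)
  set T := ∫ V : U n, (V : Mat n) * X * (V : Mat n)ᴴ ∂(haarU n) with hTdef
  have hcomm : ∀ W : U n, (W : Mat n) * T = T * W := fun W => by
    have h1 : (W : Mat n) * T * (W : Mat n)ᴴ = T := by
      have h2 := (sandwich (W : Mat n) (W : Mat n)ᴴ).integral_comp_comm hint
      rw [← hTdef, sandwich_apply] at h2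
      rw [← h2, hTdef,
        ← integral_mul_left_eq_self (fun V : U n => (V : Mat n) * X * (V : Mat n)ᴴ) W]
      congr 1 with V : 1
      simp [sandwich_apply, mul_assoc]
    have h3 : (W : Mat n)ᴴ * W = 1 := Matrix.mem_unitaryGroup_iff'.mp W.2
    calc (W : Mat n) * T = W * T * ((W : Mat n)ᴴ * W) := by rw [h3, mul_one]
      _ = T * W := by rw [← mul_assoc, h1]
  obtain ⟨c, hc⟩ := exists_smul_one_of_commute_unitary T hcomm
  have htr : T.trace = X.trace := by
    have h2 := (Matrix.traceLinearMap (Fin n) ℂ ℂ).toContinuousLinearMap.integral_comp_comm hint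
    have h4 : ∀ V : U n, ((V : Mat n) * X * (V : Mat n)ᴴ).trace = X.trace := fun V => by
      have h3 : (V : Mat n)ᴴ * V = 1 := Matrix.mem_unitaryGroup_iff'.mp V.2
      rw [Matrix.trace_mul_comm, ← mul_assoc, h3, one_mul]
    simp only [LinearMap.coe_toContinuousLinearMap', Matrix.traceLinearMap_apply, h4,
      integral_const, probReal_univ, one_smul] at h2
    exact h2.symm
  rcases Nat.eq_zero_or_pos n with rfl | hn
  · exact Subsingleton.elim _ _
  rw [hc] at htr ⊢
  rw [← htr]
  have : (n : ℂ) ≠ 0 := by exact_mod_cast hn.ne'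
  simp [this]

section Design

variable {D : Measure (U n)} (hD : IsUnitaryOneDesign D)
include hD

theorem IsUnitaryOneDesign.integral_conj (X : Mat n) :
    ∫ V : U n, (V : Mat n) * X * (V : Mat n)ᴴ ∂D = (X.trace / n) • (1 : Mat n) :=
  (hD X).trans (integral_haarU_conj X)

/-- This is the `(i, k)` entry of the average of `V e_{jl} V†`. -/
theorem IsUnitaryOneDesign.integral_entry_mul_star_entry [IsProbabilityMeasure D] (i j k l : Fin n) :
    ∫ V : U n, (V : Mat n) i j * star ((V : Mat n) k l) ∂D
      = if i = k ∧ j = l then (1 / n : ℂ) else 0 := by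
  have h := hD.integral_conj (Matrix.single j l 1)
  have hint : Integrable (fun V : U n => (V : Mat n) * Matrix.single j l 1 * (V : Mat n)ᴴ) D :=
    integrable_of_continuous _ (by fun_prop)
  have h2 := (Matrix.entryLinearMap ℂ ℂ i k).toContinuousLinearMap.integral_comp_comm hint
  rw [h] at h2
  have h3 : ∀ V : U n, ((V : Mat n) * Matrix.single j l 1 * (V : Mat n)ᴴ : Mat n) i k
      = (V : Mat n) i j * star ((V : Mat n) k l) := fun V => by
    rw [mul_assoc, Matrix.mul_apply, Finset.sum_eq_single j]
    · simp
    · intro b _ hb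
      simp [hb]
    · simp
  simp only [LinearMap.coe_toContinuousLinearMap', Matrix.entryLinearMap_apply, h3] at h2
  rw [h2]
  by_cases hjl : j = l
  · subst hjl
    by_cases hik : i = k <;> simp [hik]
  · simp [hjl, Matrix.trace_single_eq_of_ne]

/-- The design condition concerns `V X V†`. The opposite order, needed for the terms `Â†Â` and for
`B`, is recovered from the entrywise moments. -/
theorem IsUnitaryOneDesign.integral_conj' [IsProbabilityMeasure D] (X : Mat n) :
    ∫ V : U n, (V : Mat n)ᴴ * X * (V : Mat n) ∂D = (X.trace / n) • (1 : Mat n) := by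
  have hint : Integrable (fun V : U n => (V : Mat n)ᴴ * X * (V : Mat n)) D :=
    integrable_of_continuous _ (by fun_prop)
  ext i j
  have h2 := (Matrix.entryLinearMap ℂ ℂ i j).toContinuousLinearMap.integral_comp_comm hint
  simp only [LinearMap.coe_toContinuousLinearMap', Matrix.entryLinearMap_apply] at h2
  rw [← h2]
  have h3 : ∀ V : U n, ((V : Mat n)ᴴ * X * (V : Mat n) : Mat n) i j
      = ∑ k, ∑ l, X l k * ((V : Mat n) k j * star ((V : Mat n) l i)) := fun V => by
    simp only [Matrix.mul_apply, Matrix.conjTranspose_apply, Finset.sum_mul]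
    exact Finset.sum_congr rfl fun k _ => Finset.sum_congr rfl fun l _ => by ring
  simp only [h3]
  have hent : ∀ a b : Fin n, Continuous fun V : U n => (V : Mat n) a b := fun a b =>
    (Matrix.entryLinearMap ℂ ℂ a b).toContinuousLinearMap.continuous.comp continuous_coe_unitary
  have hc : ∀ k l, Integrable
      (fun V : U n => X l k * ((V : Mat n) k j * star ((V : Mat n) l i))) D :=
    fun k l => integrable_of_continuous _
      (continuous_const.mul ((hent k j).mul (continuous_star.comp (hent l i))))
  rw [integral_finsetSum _ fun k _ => integrable_finsetSum _ fun l _ => hc k l]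
  simp_rw [integral_finsetSum _ fun l _ => hc _ l, integral_const_mul,
    hD.integral_entry_mul_star_entry]
  by_cases hij : i = j
  · subst hij
    simp [Matrix.trace, div_eq_mul_inv, Finset.sum_mul]
  · simp [hij, Ne.symm hij]

end Design

end CKG
namespace CKG

variable {n : ℕ}

/-! ### Filter functions -/

section Filters

variable {β σ : ℝ}

theorem windowHat_pos (hσ : 0 < σ) (x : ℝ) : 0 < windowHat σ x := by
  unfold windowHat; positivity

theorem windowHat_neg (x : ℝ) : windowHat σ (-x) = windowHat σ x := by
  simp [windowHat]

theorem continuous_windowHat : Continuous (windowHat σ) := by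
  unfold windowHat; fun_prop

theorem gam_pos (ω : ℝ) : 0 < gam β σ ω := Real.exp_pos _

theorem gam_le_one (hβ : 0 < β) (ω : ℝ) : gam β σ ω ≤ 1 := by
  unfold gam
  rw [Real.exp_le_one_iff, neg_nonpos]
  positivity

theorem continuous_gam : Continuous (gam β σ) := by
  unfold gam; fun_prop

theorem antitone_gam (hβ : 0 < β) : Antitone (gam β σ) := fun a b h => by
  unfold gam
  gcongr

theorem windowHat_le (hσ : 0 < σ) (x : ℝ) :
    windowHat σ x ≤ 1 / Real.sqrt (σ * Real.sqrt (2 * Real.pi)) := by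
  unfold windowHat
  refine mul_le_of_le_one_right (by positivity) (Real.exp_le_one_iff.mpr ?_)
  rw [neg_nonpos]
  positivity

theorem integrable_windowHat (hσ : 0 < σ) : Integrable (windowHat σ) := by
  have h := (integrable_exp_neg_mul_sq (b := 1 / (4 * σ ^ 2)) (by positivity)).const_mul
    (1 / Real.sqrt (σ * Real.sqrt (2 * Real.pi)))
  refine h.congr (Eventually.of_forall fun x => ?_)
  simp only [windowHat]
  congr 2
  ring

theorem integrable_theta (hβ : 0 < β) (hσ : 0 < σ) (ν₁ ν₂ : ℝ) :
    Integrable fun ω => windowHat σ (ω - ν₁) * windowHat σ (ω - ν₂) * gam β σ ω := by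
  refine Integrable.mono' (((integrable_windowHat hσ).comp_sub_right ν₁).mul_const
    (1 / Real.sqrt (σ * Real.sqrt (2 * Real.pi)))) ?_ (Eventually.of_forall fun ω => ?_)
  · exact Continuous.aestronglyMeasurable (((continuous_windowHat.comp
      (continuous_id.sub continuous_const)).mul (continuous_windowHat.comp
      (continuous_id.sub continuous_const))).mul continuous_gam)
  · have h1 := windowHat_pos hσ (ω - ν₁)
    have h2 := windowHat_pos hσ (ω - ν₂)
    have h3 := gam_pos (β := β) (σ := σ) ω
    rw [Real.norm_of_nonneg (by positivity)]
    refine (mul_le_of_le_one_right (by positivity) (gam_le_one hβ ω)).trans ?_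
    exact mul_le_mul_of_nonneg_left (windowHat_le hσ _) h1.le

/-- So `f̂²` is the centred normal density of variance `σ²`. -/
theorem windowHat_mul_self (hσ : 0 < σ) (x : ℝ) : windowHat σ x * windowHat σ x
    = 1 / (σ * Real.sqrt (2 * Real.pi)) * Real.exp (-(1 / (2 * σ ^ 2)) * x ^ 2) := by
  unfold windowHat
  rw [mul_mul_mul_comm, ← Real.exp_add, div_mul_div_comm, one_mul,
    Real.mul_self_sqrt (by positivity)]
  congr 2
  field_simp
  ring

theorem integral_Ioi_windowHat_mul_self (hσ : 0 < σ) :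
    ∫ x in Set.Ioi (0 : ℝ), windowHat σ x * windowHat σ x = 1 / 2 := by
  simp_rw [windowHat_mul_self hσ]
  rw [integral_const_mul, integral_gaussian_Ioi]
  have : Real.pi / (1 / (2 * σ ^ 2)) = σ ^ 2 * (2 * Real.pi) := by field_simp
  rw [this, Real.sqrt_mul (sq_nonneg σ) (2 * Real.pi), Real.sqrt_sq hσ.le]
  have : 0 < Real.sqrt (2 * Real.pi) := by positivity
  field_simp

/-- `α(ν)` is the mean of `γ(ν - x)` over a centred Gaussian `x`. On the half `x > 0`, of mass
`1/2`, monotonicity gives `γ(ν - x) ≥ γ(ν)`. -/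
theorem half_gam_le_alpha (hβ : 0 < β) (hσ : 0 < σ) (ν : ℝ) :
    1 / 2 * gam β σ ν ≤ alpha β σ ν := by
  have hsub : alpha β σ ν = ∫ x, windowHat σ x * windowHat σ x * gam β σ (ν - x) := by
    rw [alpha, theta, ← integral_sub_left_eq_self _ _ ν]
    congr 1 with x
    rw [show ν - x - ν = -x by ring, windowHat_neg]
  have hint : Integrable fun x => windowHat σ x * windowHat σ x * gam β σ (ν - x) := by
    refine ((integrable_theta hβ hσ ν ν).comp_sub_left ν).congr (Eventually.of_forall fun x => ?_)
    simp only [show ν - x - ν = -x by ring, windowHat_neg]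
  -- A nonintegrable function would have integral `0` by convention, not `1/2`.
  have hint2 : IntegrableOn (fun x => windowHat σ x * windowHat σ x) (Set.Ioi 0) := by
    by_contra h
    have := integral_undef h
    rw [integral_Ioi_windowHat_mul_self hσ] at this
    norm_num at this
  rw [hsub, ← integral_Ioi_windowHat_mul_self hσ, ← integral_mul_const]
  refine le_trans ?_ (setIntegral_le_integral hint (s := Set.Ioi 0)
    (Eventually.of_forall fun x => mul_nonneg (mul_self_nonneg _) (gam_pos _).le))
  refine setIntegral_mono_on (hint2.mul_const _) hint.integrableOn measurableSet_Ioi fun x hx => ?_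
  exact mul_le_mul_of_nonneg_left (antitone_gam hβ (by simpa using le_of_lt hx))
    (mul_self_nonneg _)

theorem alpha_pos (hβ : 0 < β) (hσ : 0 < σ) (ν : ℝ) : 0 < alpha β σ ν :=
  (mul_pos one_half_pos (gam_pos ν)).trans_le (half_gam_le_alpha hβ hσ ν)

/-- The exponent of `γ(ν)` is `-max (βν + (βσ)²/2) 0`, so the bound depends on `β`, `σ`, `ν` only
through `K` and `C`. This makes the gap estimate uniform in `n`. -/
theorem half_exp_le_alpha {K C : ℝ} (hβ : 0 < β) (hσ : 0 < σ) (hK : β * σ ≤ K) {ν : ℝ}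
    (hν : β * ν ≤ C) : 1 / 2 * Real.exp (-max (C + K ^ 2 / 2) 0) ≤ alpha β σ ν := by
  refine le_trans ?_ (half_gam_le_alpha hβ hσ ν)
  unfold gam
  rw [mul_max_of_nonneg _ _ hβ.le, mul_zero]
  have : β * (ν + β * σ ^ 2 / 2) ≤ C + K ^ 2 / 2 := by
    have : (β * σ) ^ 2 ≤ K ^ 2 := by gcongr
    linarith [this, hν, show β * (ν + β * σ ^ 2 / 2) = β * ν + (β * σ) ^ 2 / 2 by ring]
  gcongr

/-- Detailed balance: `α(ν) = e^{-βν} α(-ν)`. -/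
theorem alpha_eq_exp_mul_alpha_neg (hσ : 0 < σ) (ν : ℝ) :
    alpha β σ ν = Real.exp (-(β * ν)) * alpha β σ (-ν) := by
  -- The reflection `ω ↦ -βσ² - ω` sends `y = ω + βσ²/2` to `-y`. Since `max (-y) 0 = max y 0 - y`,
  -- the filter gains a factor `e^{βy}`, which combines with the Gaussian cross term to leave
  -- exactly `e^{-βν}`.
  rw [alpha, theta, alpha, theta, ← integral_sub_left_eq_self
    (fun ω => windowHat σ (ω - ν) * windowHat σ (ω - ν) * gam β σ ω) volume (-(β * σ ^ 2)),
    ← integral_const_mul]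
  congr 1 with ω
  simp only [windowHat_mul_self hσ, gam, mul_assoc, ← Real.exp_add]
  rw [mul_left_comm, ← Real.exp_add]
  congr 2
  set y := ω + β * σ ^ 2 / 2 with hy
  have h1 : -(β * σ ^ 2) - ω + β * σ ^ 2 / 2 = -y := by rw [hy]; ring
  have h2 : max (-y) 0 = max y 0 - y := by
    rcases le_total y 0 with h | h
    · rw [max_eq_left (by linarith), max_eq_right h]; ring
    · rw [max_eq_right (by linarith), max_eq_left h]; ring
  rw [h1, h2, hy]
  field_simp
  ring

/-- The Fourier transform of the Gaussian window. -/
theorem integral_window (hσ : 0 < σ) (ω ν : ℝ) :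
    ((1 / Real.sqrt (2 * Real.pi) : ℝ) : ℂ) * ∫ t : ℝ, Complex.exp (-(Complex.I * ω * t)) *
      (window σ t : ℂ) * Complex.exp (Complex.I * t * ν) = (windowHat σ (ω - ν) : ℂ) := by
  have hre : 0 < ((σ ^ 2 : ℝ) : ℂ).re := by rw [Complex.ofReal_re]; positivity
  have h := fourierIntegral_gaussian hre ((ν - ω : ℝ) : ℂ)
  have hfun : ∀ t : ℝ, Complex.exp (-(Complex.I * ω * t)) * (window σ t : ℂ) *
      Complex.exp (Complex.I * t * ν) = (Real.sqrt (σ * Real.sqrt (2 / Real.pi)) : ℂ) *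
      (Complex.exp (Complex.I * ((ν - ω : ℝ) : ℂ) * t) *
        Complex.exp (-((σ ^ 2 : ℝ) : ℂ) * t ^ 2)) := fun t => by
    simp only [window, Complex.ofReal_mul, Complex.ofReal_exp]
    rw [← Complex.exp_add, mul_right_comm, ← mul_assoc, ← Complex.exp_add, ← Complex.exp_add,
      mul_comm]
    congr 2
    push_cast
    ring
  simp_rw [hfun]
  rw [integral_const_mul, h]
  have hsq : ((Real.pi : ℂ) / ((σ ^ 2 : ℝ) : ℂ)) ^ (1 / 2 : ℂ)
      = (Real.sqrt (Real.pi / σ ^ 2) : ℂ) := by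
    rw [Real.sqrt_eq_rpow, Complex.ofReal_cpow (by positivity)]
    push_cast
    rfl
  have hexp : Complex.exp (-((ν - ω : ℝ) : ℂ) ^ 2 / (4 * ((σ ^ 2 : ℝ) : ℂ)))
      = (Real.exp (-((ω - ν) ^ 2 / (4 * σ ^ 2))) : ℂ) := by
    push_cast
    congr 1
    ring
  rw [hsq, hexp]
  norm_cast
  unfold windowHat
  simp only [← mul_assoc]
  congr 1
  have hpi := Real.pi_pos
  rw [eq_div_iff (by positivity), ← sq_eq_sq₀ (by positivity) (by positivity)]
  simp only [mul_pow, div_pow, one_pow]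
  rw [Real.sq_sqrt (by positivity), Real.sq_sqrt (by positivity), Real.sq_sqrt (by positivity),
    Real.sq_sqrt (by positivity)]
  have h1 : Real.sqrt (2 / Real.pi) * Real.sqrt (2 * Real.pi) = 2 := by
    rw [← Real.sqrt_mul (by positivity),
      show 2 / Real.pi * (2 * Real.pi) = 2 ^ 2 by field_simp]
    exact Real.sqrt_sq (by norm_num)
  calc _ = (Real.sqrt (2 / Real.pi) * Real.sqrt (2 * Real.pi)) * (1 / 2) := by field_simp
    _ = 1 := by rw [h1]; norm_num

end Filters

end CKG
namespace CKG

variable {n : ℕ}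

/-! ### Matrix units of an orthonormal basis -/

theorem ketbra_mul_ketbra (x y z w : EuclideanSpace ℂ (Fin n)) :
    ketbra x y * ketbra z w = inner ℂ y z • ketbra x w := by
  rw [ketbra, ketbra, Matrix.vecMulVec_mul_vecMulVec, EuclideanSpace.inner_eq_star_dotProduct,
    dotProduct_comm, Matrix.vecMulVec_smul]
  rfl

theorem ketbra_mul_mul_ketbra (x y z w : EuclideanSpace ℂ (Fin n)) (N : Mat n) :
    ketbra x y * N * ketbra z w = (ketbra z y * N).trace • ketbra x w := by
  simp only [ketbra, Matrix.vecMulVec_mul, Matrix.trace_vecMulVec, Matrix.vecMul_vecMulVec,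
    Matrix.vecMulVec_smul]
  rw [dotProduct_comm]

theorem conjTranspose_ketbra (x y : EuclideanSpace ℂ (Fin n)) : (ketbra x y)ᴴ = ketbra y x := by
  ext i j
  simp [ketbra, Matrix.vecMulVec_apply, mul_comm]

theorem trace_ketbra (x y : EuclideanSpace ℂ (Fin n)) : (ketbra x y).trace = inner ℂ y x := by
  rw [ketbra, Matrix.trace_vecMulVec, EuclideanSpace.inner_eq_star_dotProduct]

section Basis

variable (v : OrthonormalBasis (Fin n) ℂ (EuclideanSpace ℂ (Fin n)))

theorem ketbra_basis_mul (a b c d : Fin n) :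
    ketbra (v a) (v b) * ketbra (v c) (v d) = if b = c then ketbra (v a) (v d) else 0 := by
  rw [ketbra_mul_ketbra, v.inner_eq_ite]
  split_ifs <;> simp

theorem trace_ketbra_basis (a b : Fin n) :
    (ketbra (v a) (v b)).trace = if a = b then 1 else 0 := by
  rw [trace_ketbra, v.inner_eq_ite]
  simp [eq_comm]

theorem sum_ketbra_basis : ∑ l, ketbra (v l) (v l) = 1 := by
  apply Matrix.ext_of_mulVec_single
  intro i
  have h := v.sum_repr (EuclideanSpace.single i 1)
  have h2 := congrArg WithLp.ofLp h
  simp only [WithLp.ofLp_sum, WithLp.ofLp_smul, v.repr_apply_apply] at h2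
  rw [Matrix.one_mulVec, Matrix.sum_mulVec]
  refine Eq.trans (Finset.sum_congr rfl fun l _ => ?_) h2
  ext j
  simp [ketbra, EuclideanSpace.inner_eq_star_dotProduct, Matrix.vecMulVec_apply, mul_comm]

theorem sum_ketbra_mul_mul_ketbra (N : Mat n) :
    ∑ l, ∑ m, ketbra (v l) (v l) * N * ketbra (v m) (v m) = N := by
  simp_rw [← Finset.mul_sum, sum_ketbra_basis, mul_one, ← Finset.sum_mul, sum_ketbra_basis, one_mul]

variable {v} {H : Mat n} {E : Fin n → ℝ}
  (hv : ∀ j, Matrix.toEuclideanLin H (v j) = (E j : ℂ) • v j)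
include hv

theorem mul_ketbra_of_eigenvector (j : Fin n) :
    H * ketbra (v j) (v j) = (E j : ℂ) • ketbra (v j) (v j) := by
  have h : H *ᵥ (v j).ofLp = (E j : ℂ) • (v j).ofLp := congrArg WithLp.ofLp (hv j)
  rw [ketbra, Matrix.mul_vecMulVec, h, Matrix.smul_vecMulVec]

theorem exp_mul_ketbra_of_eigenvector (s : ℂ) (j : Fin n) :
    NormedSpace.exp (s • H) * ketbra (v j) (v j) = Complex.exp (s * E j) • ketbra (v j) (v j) := by
  have hpow : ∀ k : ℕ, (s • H) ^ k * ketbra (v j) (v j) = (s * E j) ^ k • ketbra (v j) (v j) := by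
    intro k
    induction k with
    | zero => simp
    | succ k ih =>
      rw [pow_succ, mul_assoc, smul_mul_assoc, mul_ketbra_of_eigenvector hv, smul_smul,
        mul_smul_comm, ih, smul_smul, pow_succ, mul_comm]
  have h1 := (NormedSpace.exp_series_hasSum_exp' (𝕂 := ℂ) (s • H)).mul_right (ketbra (v j) (v j))
  have h2 := (NormedSpace.exp_series_hasSum_exp' (𝕂 := ℂ) (s * E j : ℂ)).smul_const
    (ketbra (v j) (v j))
  rw [← Complex.exp_eq_exp_ℂ] at h2
  refine h1.unique (h2.congr_fun fun k => ?_)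
  rw [smul_mul_assoc, hpow, smul_assoc]

/-- Adjoint of the left-hand version at `star s`, using `H† = H`. -/
theorem ketbra_mul_exp_of_eigenvector (hH : H.IsHermitian) (s : ℂ) (j : Fin n) :
    ketbra (v j) (v j) * NormedSpace.exp (s • H) = Complex.exp (s * E j) • ketbra (v j) (v j) := by
  have h := congrArg Matrix.conjTranspose (exp_mul_ketbra_of_eigenvector hv (star s) j)
  rw [Matrix.conjTranspose_mul, conjTranspose_ketbra, ← Matrix.exp_conjTranspose] at h
  simpa [conjTranspose_ketbra, hH.eq, ← Complex.exp_conj] using h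

/-- The operator Fourier transform in an energy eigenbasis. -/
theorem oft_eq_sum (hH : H.IsHermitian) {σ : ℝ} (hσ : 0 < σ) (A : Mat n) (ω : ℝ) :
    oft H σ A ω = ∑ p : Fin n × Fin n, (windowHat σ (ω - (E p.1 - E p.2)) : ℂ) •
      (ketbra (v p.1) (v p.1) * A * ketbra (v p.2) (v p.2)) := by
  -- Heisenberg evolution multiplies the `(l, m)` component by the phase `e^{it(E_l - E_m)}`, so the
  -- transform can be taken component by component.
  have hheis : ∀ t : ℝ,
      NormedSpace.exp ((Complex.I * t) • H) * A * NormedSpace.exp (-((Complex.I * t) • H))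
        = ∑ p : Fin n × Fin n, Complex.exp (Complex.I * t * (E p.1 - E p.2 : ℝ)) •
          (ketbra (v p.1) (v p.1) * A * ketbra (v p.2) (v p.2)) := fun t => by
    rw [← neg_smul, ← sum_ketbra_mul_mul_ketbra v (NormedSpace.exp ((Complex.I * t) • H) * A *
      NormedSpace.exp ((-(Complex.I * t)) • H)), Fintype.sum_prod_type]
    refine Finset.sum_congr rfl fun l _ => Finset.sum_congr rfl fun m _ => ?_
    rw [← mul_assoc, ← mul_assoc, mul_assoc (_ * A), ketbra_mul_exp_of_eigenvector hv hH,
      exp_mul_ketbra_of_eigenvector hv, smul_mul_assoc, smul_mul_assoc, mul_smul_comm, smul_smul,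
      ← Complex.exp_add]
    congr 2
    push_cast
    ring
  have hint : ∀ p : Fin n × Fin n, Integrable fun t : ℝ => (Complex.exp (-(Complex.I * ω * t)) *
      (window σ t : ℂ) * Complex.exp (Complex.I * t * (E p.1 - E p.2 : ℝ))) := fun p => by
    have hw : Integrable (window σ) := by
      refine ((integrable_exp_neg_mul_sq (b := σ ^ 2) (by positivity)).mul_const
        (Real.sqrt (σ * Real.sqrt (2 / Real.pi)))).congr (Eventually.of_forall fun t => ?_)
      simp [window]
    have hcont : Continuous fun t : ℝ => (Complex.exp (-(Complex.I * ω * t)) *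
        (window σ t : ℂ) * Complex.exp (Complex.I * t * (E p.1 - E p.2 : ℝ))) := by
      unfold window
      fun_prop
    refine hw.norm.mono' hcont.aestronglyMeasurable (Eventually.of_forall fun t => ?_)
    simp [Complex.norm_exp]
  unfold oft
  simp_rw [hheis, Finset.smul_sum, smul_smul]
  rw [integral_finsetSum _ fun p _ => (hint p).smul_const _, Finset.smul_sum]
  refine Finset.sum_congr rfl fun p _ => ?_
  rw [integral_smul_const, smul_smul, integral_window hσ]

end Basis

end CKG
namespace CKG

variable {n : ℕ}

/-! ### The Lindbladian in an energy eigenbasis and its average -/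

/-- The polarized dissipator `N ↦ X N Y† - ½ {Y† X, N}`. -/
noncomputable def dissipator (X Y : Mat n) : Superop n :=
  sandwich X Yᴴ - (1 / 2 : ℂ) • anticomm (Yᴴ * X)

theorem comm_apply (X N : Mat n) : comm X N = X * N - N * X := by
  simp [comm, sandwich_apply]

theorem anticomm_apply (X N : Mat n) : anticomm X N = X * N + N * X := by
  simp [anticomm, sandwich_apply]

theorem dissipator_apply (X Y N : Mat n) :
    dissipator X Y N = X * N * Yᴴ - (1 / 2 : ℂ) • (Yᴴ * X * N + N * (Yᴴ * X)) := by
  simp [dissipator, sandwich_apply, anticomm_apply]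

theorem continuous_comm_comp {X : Type*} [TopologicalSpace X] {f : X → Mat n}
    (hf : Continuous f) : Continuous fun x => comm (f x) := by
  unfold comm sandwich; fun_prop

theorem continuous_dissipator_comp {X : Type*} [TopologicalSpace X] {f g : X → Mat n}
    (hf : Continuous f) (hg : Continuous g) : Continuous fun x => dissipator (f x) (g x) := by
  unfold dissipator anticomm sandwich; fun_prop

/-- The dissipator is linear in `X` and conjugate-linear in `Y`; real coefficients pass through the
adjoint unchanged. -/
theorem dissipator_sum_smul {ι : Type*} [Fintype ι] (a : ι → ℝ) (X : ι → Mat n) :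
    dissipator (∑ p, (a p : ℂ) • X p) (∑ p, (a p : ℂ) • X p)
      = ∑ p, ∑ q, ((a p * a q : ℝ) : ℂ) • dissipator (X p) (X q) := by
  ext1 N
  simp only [dissipator_apply, Matrix.conjTranspose_sum, Matrix.conjTranspose_smul,
    Complex.star_def, Complex.conj_ofReal, _root_.sum_apply,
    _root_.smul_apply, smul_sub, Finset.sum_sub_distrib, smul_add,
    Finset.sum_add_distrib]
  congr 1
  · simp only [Finset.sum_mul, Finset.mul_sum, smul_mul_assoc, mul_smul_comm, smul_smul,
      Finset.smul_sum, Complex.ofReal_mul]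
    rw [Finset.sum_comm]
    refine Finset.sum_congr rfl fun p _ => Finset.sum_congr rfl fun q _ => ?_
    congr 1
    ring
  congr 1 <;>
  · simp only [Finset.sum_mul, Finset.mul_sum, smul_mul_assoc, mul_smul_comm, smul_smul,
      Finset.smul_sum, Complex.ofReal_mul]
    refine Finset.sum_congr rfl fun p _ => Finset.sum_congr rfl fun q _ => ?_
    congr 1
    ring

theorem integral_sum_sum_ofReal_smul {ι : Type*} [Fintype ι] (f : ι → ι → ℝ → ℝ)
    (hf : ∀ p q, Integrable (f p q)) (X : ι → ι → Superop n) :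
    ∫ ω, ∑ p, ∑ q, (f p q ω : ℂ) • X p q = ∑ p, ∑ q, ((∫ ω, f p q ω : ℝ) : ℂ) • X p q := by
  have hint : ∀ p q, Integrable fun ω => (f p q ω : ℂ) • X p q := fun p q =>
    Integrable.smul_const (hf p q).ofReal (X p q)
  rw [integral_finsetSum _ fun p _ => integrable_finsetSum _ fun q _ => hint p q]
  refine Finset.sum_congr rfl fun p _ => ?_
  rw [integral_finsetSum _ fun q _ => hint p q]
  refine Finset.sum_congr rfl fun q _ => ?_
  rw [integral_smul_const, integral_complex_ofReal]

/-- The component `|l⟩⟨l| A |m⟩⟨m|` of `A` for `p = (l, m)`. -/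
noncomputable def transitionPart (v : OrthonormalBasis (Fin n) ℂ (EuclideanSpace ℂ (Fin n)))
    (A : Mat n) (p : Fin n × Fin n) : Mat n :=
  ketbra (v p.1) (v p.1) * A * ketbra (v p.2) (v p.2)

theorem continuous_transitionPart (v : OrthonormalBasis (Fin n) ℂ (EuclideanSpace ℂ (Fin n)))
    (p : Fin n × Fin n) : Continuous fun A => transitionPart v A p := by
  unfold transitionPart; fun_prop

section Eigenbasis

variable {v : OrthonormalBasis (Fin n) ℂ (EuclideanSpace ℂ (Fin n))} {H : Mat n} {E : Fin n → ℝ}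
  (hv : ∀ j, Matrix.toEuclideanLin H (v j) = (E j : ℂ) • v j) (hH : H.IsHermitian) {β σ : ℝ}

-- The frequency `ω` occurs only in the scalars `f̂(ω - ν_p) f̂(ω - ν_q) γ(ω)`, whose integral is
-- `θ(ν_p, ν_q)`. The coherent term is left unexpanded because only its average matters.
include hv in
theorem jumpLindbladian_eq (hβ : 0 < β) (hσ : 0 < σ) (V : U n) :
    jumpLindbladian hH β σ V
      = (-Complex.I) • comm (coherentB hH β σ fun _ : Unit => (V : Mat n)) +
        ∑ p : Fin n × Fin n, ∑ q : Fin n × Fin n,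
          (theta β σ (E p.1 - E p.2) (E q.1 - E q.2) : ℂ) •
            dissipator (transitionPart v V p) (transitionPart v V q) := by
  unfold jumpLindbladian lindbladian
  congr 1
  rw [Fintype.sum_unique]
  have hfun : ∀ ω : ℝ, (gam β σ ω : ℂ) • (sandwich (oft H σ V ω) (oft H σ V ω)ᴴ
      - (1 / 2 : ℂ) • anticomm ((oft H σ V ω)ᴴ * oft H σ V ω))
      = ∑ p : Fin n × Fin n, ∑ q : Fin n × Fin n,
        ((windowHat σ (ω - (E p.1 - E p.2)) * windowHat σ (ω - (E q.1 - E q.2)) * gam β σ ω : ℝ) : ℂ)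
          • dissipator (transitionPart v V p) (transitionPart v V q) := fun ω => by
    change (gam β σ ω : ℂ) • dissipator (oft H σ V ω) (oft H σ V ω) = _
    rw [oft_eq_sum hv hH hσ]
    change (gam β σ ω : ℂ) • dissipator
      (∑ p, (windowHat σ (ω - (E p.1 - E p.2)) : ℂ) • transitionPart v V p)
      (∑ p, (windowHat σ (ω - (E p.1 - E p.2)) : ℂ) • transitionPart v V p) = _
    rw [dissipator_sum_smul]
    simp only [Finset.smul_sum, smul_smul]
    refine Finset.sum_congr rfl fun p _ => Finset.sum_congr rfl fun q _ => ?_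
    congr 1
    push_cast
    ring
  simp_rw [hfun]
  exact integral_sum_sum_ofReal_smul _ (fun p q => integrable_theta hβ hσ _ _) _

theorem bohrComponent_eq (A : Mat n) (ν : ℝ) :
    bohrComponent hH A ν = ∑ p : Fin n × Fin n,
      if hH.eigenvalues p.1 - hH.eigenvalues p.2 = ν then
        transitionPart hH.eigenvectorBasis A p else 0 := by
  rw [Fintype.sum_prod_type]
  rfl

theorem continuous_bohrComponent (ν : ℝ) : Continuous fun A => bohrComponent hH A ν := by
  simp_rw [bohrComponent_eq]
  refine continuous_finsetSum _ fun p _ => ?_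
  split_ifs
  · exact continuous_transitionPart _ p
  · exact continuous_const

theorem continuous_coherentB :
    Continuous fun V : U n => coherentB hH β σ fun _ : Unit => (V : Mat n) := by
  have hb : ∀ ν, Continuous fun V : U n => bohrComponent hH (V : Mat n) ν := fun ν =>
    (continuous_bohrComponent hH ν).comp continuous_coe_unitary
  unfold coherentB
  fun_prop

theorem toEuclideanLin_eigenvectorBasis (j : Fin n) :
    Matrix.toEuclideanLin H (hH.eigenvectorBasis j)
      = (hH.eigenvalues j : ℂ) • hH.eigenvectorBasis j := by
  ext i
  have := congrFun (hH.mulVec_eigenvectorBasis j) i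
  simpa using this

/-- Once the `ω`-integral is a finite sum, the dependence on `V` is visibly continuous. Compactness
of `U(n)` then makes the expectation exist. -/
theorem continuous_jumpLindbladian (hβ : 0 < β) (hσ : 0 < σ) :
    Continuous fun V : U n => jumpLindbladian hH β σ V := by
  simp_rw [jumpLindbladian_eq (toEuclideanLin_eigenvectorBasis hH) hH hβ hσ]
  have hB := continuous_comm_comp (continuous_coherentB hH (β := β) (σ := σ))
  have ht : ∀ r, Continuous fun V : U n => transitionPart hH.eigenvectorBasis (V : Mat n) r :=
    fun r => (continuous_transitionPart _ r).comp continuous_coe_unitary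
  have hd : ∀ p q, Continuous fun V : U n => dissipator
      (transitionPart hH.eigenvectorBasis (V : Mat n) p)
      (transitionPart hH.eigenvectorBasis (V : Mat n) q) := fun p q =>
    continuous_dissipator_comp (ht p) (ht q)
  have hsum : Continuous fun V : U n => ∑ p : Fin n × Fin n, ∑ q : Fin n × Fin n,
      (theta β σ (hH.eigenvalues p.1 - hH.eigenvalues p.2)
        (hH.eigenvalues q.1 - hH.eigenvalues q.2) : ℂ) • dissipator
          (transitionPart hH.eigenvectorBasis (V : Mat n) p)
          (transitionPart hH.eigenvectorBasis (V : Mat n) q) := by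
    fun_prop
  exact (hB.const_smul (-Complex.I)).add hsum

end Eigenbasis

section Average

variable {D : Measure (U n)} [IsProbabilityMeasure D] (hD : IsUnitaryOneDesign D)
  (v : OrthonormalBasis (Fin n) ℂ (EuclideanSpace ℂ (Fin n)))
include hD

/-- The inner product of projectors forces equal final states. The average is then scalar, and the
outer projectors force equal initial states. -/
theorem IsUnitaryOneDesign.integral_conjTranspose_transitionPart_mul (p q : Fin n × Fin n) :
    ∫ V : U n, (transitionPart v (V : Mat n) q)ᴴ * transitionPart v (V : Mat n) p ∂D
      = if p = q then (1 / n : ℂ) • ketbra (v p.2) (v p.2) else 0 := by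
  have hfun : ∀ V : U n, (transitionPart v (V : Mat n) q)ᴴ * transitionPart v (V : Mat n) p
      = sandwich (ketbra (v q.2) (v q.2)) (ketbra (v p.2) (v p.2))
        ((V : Mat n)ᴴ * (ketbra (v q.1) (v q.1) * ketbra (v p.1) (v p.1)) * (V : Mat n)) :=
    fun V => by
      simp only [transitionPart, Matrix.conjTranspose_mul, conjTranspose_ketbra, sandwich_apply,
        mul_assoc]
  simp_rw [hfun]
  rw [(sandwich _ _).integral_comp_comm (integrable_of_continuous _ (by fun_prop)),
    hD.integral_conj', sandwich_apply, ketbra_basis_mul, mul_smul_comm, smul_mul_assoc, mul_one,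
    ketbra_basis_mul]
  obtain ⟨l, m⟩ := p
  obtain ⟨l', m'⟩ := q
  by_cases h1 : l' = l
  · by_cases h2 : m' = m
    · simp [h1, h2, trace_ketbra_basis]
    · simp [h2, Ne.symm h2]
  · simp [h1, Ne.symm h1]

theorem IsUnitaryOneDesign.integral_transitionPart_mul_mul (p q : Fin n × Fin n) (N : Mat n) :
    ∫ V : U n, transitionPart v (V : Mat n) p * N * (transitionPart v (V : Mat n) q)ᴴ ∂D
      = if p = q then
          (1 / n : ℂ) • sandwich (ketbra (v p.1) (v p.2)) (ketbra (v p.2) (v p.1)) N else 0 := by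
  have hfun : ∀ V : U n, transitionPart v (V : Mat n) p * N * (transitionPart v (V : Mat n) q)ᴴ
      = sandwich (ketbra (v p.1) (v p.1)) (ketbra (v q.1) (v q.1))
        ((V : Mat n) * (ketbra (v p.2) (v p.2) * N * ketbra (v q.2) (v q.2)) * (V : Mat n)ᴴ) :=
    fun V => by
      simp only [transitionPart, Matrix.conjTranspose_mul, conjTranspose_ketbra, sandwich_apply,
        mul_assoc]
  simp_rw [hfun]
  rw [(sandwich _ _).integral_comp_comm (integrable_of_continuous _ (by fun_prop)),
    hD.integral_conj, sandwich_apply, sandwich_apply, mul_smul_comm, smul_mul_assoc, mul_one,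
    ketbra_basis_mul, ketbra_mul_mul_ketbra, ketbra_mul_mul_ketbra, Matrix.trace_smul,
    trace_ketbra_basis]
  obtain ⟨l, m⟩ := p
  obtain ⟨l', m'⟩ := q
  by_cases h1 : l = l'
  · by_cases h2 : m = m'
    · simp [h1, h2, smul_smul, div_eq_mul_inv, mul_comm]
    · simp [h2]
  · simp [h1]

theorem IsUnitaryOneDesign.integral_dissipator (p q : Fin n × Fin n) :
    ∫ V : U n, dissipator (transitionPart v (V : Mat n) p) (transitionPart v (V : Mat n) q) ∂D
      = if p = q then (1 / n : ℂ) • (sandwich (ketbra (v p.1) (v p.2)) (ketbra (v p.2) (v p.1))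
          - (1 / 2 : ℂ) • anticomm (ketbra (v p.2) (v p.2))) else 0 := by
  have ht : ∀ r, Continuous fun V : U n => transitionPart v (V : Mat n) r := fun r =>
    (continuous_transitionPart v r).comp continuous_coe_unitary
  have hp := ht p
  have hq := ht q
  ext1 N
  rw [ContinuousLinearMap.integral_apply (integrable_of_continuous _
    (continuous_dissipator_comp hp hq))]
  -- For fixed `N` the anticommutator is a linear map applied to `Y†X`, so the two first-moment
  -- formulas suffice.
  have hfun : ∀ V : U n,
      dissipator (transitionPart v (V : Mat n) p) (transitionPart v (V : Mat n) q) N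
        = transitionPart v (V : Mat n) p * N * (transitionPart v (V : Mat n) q)ᴴ
          - ((1 / 2 : ℂ) • (sandwich 1 N + sandwich N 1))
            ((transitionPart v (V : Mat n) q)ᴴ * transitionPart v (V : Mat n) p) := fun V => by
    simp [dissipator_apply, sandwich_apply]
  simp_rw [hfun]
  rw [integral_sub (integrable_of_continuous _ (by fun_prop))
    (integrable_of_continuous _ (by fun_prop)),
    ContinuousLinearMap.integral_comp_comm _ (integrable_of_continuous _ (by fun_prop)),
    hD.integral_transitionPart_mul_mul, hD.integral_conjTranspose_transitionPart_mul]
  split_ifs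
  · simp only [_root_.smul_apply, _root_.sub_apply,
      _root_.add_apply, anticomm_apply, sandwich_apply, one_mul, mul_one,
      smul_mul_assoc, mul_smul_comm]
    module
  · simp

/-- For `ν₁ ≠ ν₂` the two Bohr components have no transition in common, so their product averages to
zero. For `ν₁ = ν₂` the coefficient is `tanh 0 = 0`. -/
theorem IsUnitaryOneDesign.integral_coherentB {H : Mat n} (hH : H.IsHermitian) (β σ : ℝ) :
    ∫ V : U n, coherentB hH β σ (fun _ : Unit => (V : Mat n)) ∂D = 0 := by
  have hb : ∀ ν, Continuous fun V : U n => bohrComponent hH (V : Mat n) ν := fun ν =>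
    (continuous_bohrComponent hH ν).comp continuous_coe_unitary
  have ht : ∀ r, Continuous fun V : U n => transitionPart hH.eigenvectorBasis (V : Mat n) r :=
    fun r => (continuous_transitionPart _ r).comp continuous_coe_unitary
  simp only [coherentB, Fintype.sum_unique]
  rw [integral_finsetSum _ fun _ _ => integrable_of_continuous _ (by fun_prop)]
  refine Finset.sum_eq_zero fun ν₁ _ => ?_
  rw [integral_finsetSum _ fun _ _ => integrable_of_continuous _ (by fun_prop)]
  refine Finset.sum_eq_zero fun ν₂ _ => ?_
  by_cases hν : ν₁ = ν₂
  · simp [hν]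
  rw [integral_smul]
  refine smul_eq_zero_of_right _ ?_
  simp_rw [bohrComponent_eq, Matrix.conjTranspose_sum, Finset.sum_mul, Finset.mul_sum]
  have hterm : ∀ p q : Fin n × Fin n, Continuous fun V : U n =>
      (if hH.eigenvalues q.1 - hH.eigenvalues q.2 = ν₂ then
        transitionPart hH.eigenvectorBasis (V : Mat n) q else 0)ᴴ *
      (if hH.eigenvalues p.1 - hH.eigenvalues p.2 = ν₁ then
        transitionPart hH.eigenvectorBasis (V : Mat n) p else 0) := fun p q => by
    split_ifs <;> fun_prop
  rw [integral_finsetSum _ fun q _ => integrable_of_continuous _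
    (continuous_finsetSum _ fun p _ => hterm p q)]
  refine Finset.sum_eq_zero fun q _ => ?_
  rw [integral_finsetSum _ fun p _ => integrable_of_continuous _ (hterm p q)]
  refine Finset.sum_eq_zero fun p _ => ?_
  by_cases hq : hH.eigenvalues q.1 - hH.eigenvalues q.2 = ν₂
  · by_cases hp : hH.eigenvalues p.1 - hH.eigenvalues p.2 = ν₁
    · simp only [hp, hq, if_true]
      rw [hD.integral_conjTranspose_transitionPart_mul, if_neg]
      rintro rfl
      exact hν (hp.symm.trans hq)
    · simp [hp]
  · simp [hq]

theorem IsUnitaryOneDesign.integral_comm_coherentB {H : Mat n} (hH : H.IsHermitian) (β σ : ℝ) :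
    ∫ V : U n, comm (coherentB hH β σ fun _ : Unit => (V : Mat n)) ∂D = 0 := by
  have hB := continuous_coherentB hH (β := β) (σ := σ)
  ext1 N
  rw [ContinuousLinearMap.integral_apply (integrable_of_continuous _ (continuous_comm_comp hB))]
  have hfun : ∀ X : Mat n, comm X N = (sandwich 1 N - sandwich N 1) X := fun X => by
    simp [comm_apply, sandwich_apply]
  simp_rw [hfun]
  rw [ContinuousLinearMap.integral_comp_comm _ (integrable_of_continuous _ hB),
    hD.integral_coherentB, map_zero]
  rfl

theorem IsUnitaryOneDesign.integral_sum_dissipator (c : Fin n × Fin n → Fin n × Fin n → ℂ) :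
    ∫ V : U n, ∑ p, ∑ q, c p q • dissipator (transitionPart v (V : Mat n) p)
        (transitionPart v (V : Mat n) q) ∂D
      = ∑ p, (c p p / n : ℂ) • (sandwich (ketbra (v p.1) (v p.2)) (ketbra (v p.2) (v p.1))
          - (1 / 2 : ℂ) • anticomm (ketbra (v p.2) (v p.2))) := by
  have ht : ∀ r, Continuous fun V : U n => transitionPart v (V : Mat n) r := fun r =>
    (continuous_transitionPart v r).comp continuous_coe_unitary
  have hd : ∀ p q, Continuous fun V : U n =>
      dissipator (transitionPart v (V : Mat n) p) (transitionPart v (V : Mat n) q) := fun p q =>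
    continuous_dissipator_comp (ht p) (ht q)
  have hint : ∀ p q, Integrable (fun V : U n => c p q • dissipator (transitionPart v (V : Mat n) p)
      (transitionPart v (V : Mat n) q)) D := fun p q =>
    integrable_of_continuous (E := Superop n) D ((hd p q).const_smul (c p q))
  rw [integral_finsetSum _ fun p _ => integrable_finsetSum _ fun q _ => hint p q]
  refine Finset.sum_congr rfl fun p _ => ?_
  rw [integral_finsetSum _ fun q _ => hint p q]
  have hval : ∀ q, ∫ V : U n, c p q • dissipator (transitionPart v (V : Mat n) p)
      (transitionPart v (V : Mat n) q) ∂D = c p q • (if p = q then (1 / n : ℂ) •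
        (sandwich (ketbra (v p.1) (v p.2)) (ketbra (v p.2) (v p.1))
          - (1 / 2 : ℂ) • anticomm (ketbra (v p.2) (v p.2))) else 0) := fun q => by
    rw [integral_smul, hD.integral_dissipator]
  rw [Finset.sum_congr rfl fun q _ => hval q, Finset.sum_eq_single p
    (fun q _ hq => by rw [if_neg hq.symm]; exact smul_zero (A := Superop n) (c p q)) (by simp),
    if_pos rfl, smul_smul, mul_one_div]

variable {v}

theorem IsUnitaryOneDesign.averageLindbladian_eq_sum {H : Mat n} (hH : H.IsHermitian)
    {E : Fin n → ℝ} (hv : ∀ j, Matrix.toEuclideanLin H (v j) = (E j : ℂ) • v j) {β σ : ℝ}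
    (hβ : 0 < β) (hσ : 0 < σ) :
    averageLindbladian hH β σ D = ∑ p : Fin n × Fin n,
      (alpha β σ (E p.1 - E p.2) / n : ℂ) •
        (sandwich (ketbra (v p.1) (v p.2)) (ketbra (v p.2) (v p.1))
          - (1 / 2 : ℂ) • anticomm (ketbra (v p.2) (v p.2))) := by
  have hB : Integrable (fun V : U n =>
      (-Complex.I) • comm (coherentB hH β σ fun _ : Unit => (V : Mat n))) D :=
    integrable_of_continuous (E := Superop n) D
      ((continuous_comm_comp (continuous_coherentB hH)).const_smul (-Complex.I))
  have hL := integrable_of_continuous (E := Superop n) D (continuous_jumpLindbladian hH hβ hσ)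
  -- Subtracting the mean-zero coherent term leaves the double sum of dissipators without changing
  -- the average.
  have hsplit : ∀ V : U n, jumpLindbladian hH β σ V
      - (-Complex.I) • comm (coherentB hH β σ fun _ : Unit => (V : Mat n)) = _ := fun V =>
    sub_eq_of_eq_add' (jumpLindbladian_eq hv hH hβ hσ V)
  have hzero : ∫ V : U n, (-Complex.I) • comm (coherentB hH β σ fun _ : Unit => (V : Mat n)) ∂D
      = 0 := by
    rw [integral_smul, hD.integral_comm_coherentB, smul_zero]
  have h := integral_sub hL hB
  rw [hzero, sub_zero, integral_congr_ae (Eventually.of_forall hsplit),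
    hD.integral_sum_dissipator] at h
  exact h.symm

end Average

end CKG
namespace CKG

variable {n : ℕ}

/-! ### Classical and dephasing parts -/

/-- Intended with `T l m = |l⟩⟨m| · |m⟩⟨l|` and `S l m = |l⟩⟨l| · |m⟩⟨m|`, which agree for `l = m`.
The diagonal losses thus join the gain terms as the diagonal of `Q`, and the off-diagonal ones are
the dephasing. -/
theorem sum_smul_sub_half_smul_sum {M : Type*} [AddCommGroup M] [Module ℂ M]
    (a : Fin n → Fin n → ℂ) (T S : Fin n → Fin n → M) (hTS : ∀ m, T m m = S m m) :
    ∑ l, ∑ m, a l m • (T l m - (1 / 2 : ℂ) • ∑ k, (S m k + S k m))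
      = ∑ l, ∑ m, (a l m - if l = m then ∑ j, a j m else 0) • T l m
        - ∑ l, ∑ m ∈ Finset.univ.erase l, ((1 / 2 : ℂ) * ∑ j, (a j l + a j m)) • S l m := by
  have h1 : ∀ l, ∑ m ∈ Finset.univ.erase l, ((1 / 2 : ℂ) * ∑ j, (a j l + a j m)) • S l m
      = ∑ m, ((1 / 2 : ℂ) * ∑ j, (a j l + a j m)) • S l m - (∑ j, a j l) • S l l := fun l => by
    rw [Finset.sum_erase_eq_sub (Finset.mem_univ l)]
    congr 2
    rw [Finset.sum_add_distrib]
    ring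
  have h2 : ∑ l, ∑ m, a l m • (1 / 2 : ℂ) • ∑ k, (S m k + S k m)
      = ∑ l, ∑ m, ((1 / 2 : ℂ) * ∑ j, (a j l + a j m)) • S l m := by
    have h3 : ∀ m k, ((1 / 2 : ℂ) * ∑ j, (a j m + a j k)) • S m k
        = ((1 / 2 : ℂ) * ∑ j, a j m) • S m k + ((1 / 2 : ℂ) * ∑ j, a j k) • S m k := fun m k => by
      rw [Finset.sum_add_distrib, mul_add, add_smul]
    simp_rw [h3, Finset.sum_add_distrib, smul_add, Finset.sum_add_distrib]
    congr 1
    · rw [Finset.sum_comm]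
      refine Finset.sum_congr rfl fun m _ => ?_
      rw [← Finset.sum_smul, ← Finset.smul_sum, smul_smul, mul_comm]
    · rw [Finset.sum_comm, Finset.sum_comm (f := fun m k => ((1 / 2 : ℂ) * ∑ j, a j k) • S m k)]
      refine Finset.sum_congr rfl fun m _ => ?_
      rw [← Finset.sum_smul, ← Finset.smul_sum, smul_smul, mul_comm]
  have h4 : ∑ l, ∑ m, (if l = m then ∑ j, a j m else 0) • T l m
      = ∑ l, (∑ j, a j l) • S l l := by
    refine Finset.sum_congr rfl fun l _ => ?_
    rw [Finset.sum_eq_single l (fun m _ hm => by rw [if_neg hm.symm, zero_smul]) (by simp),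
      if_pos rfl, hTS]
  simp_rw [h1, smul_sub, sub_smul, Finset.sum_sub_distrib, h2, h4]
  abel

/-- The fictitious jump `m → m` cancels between gain and loss, so the loss may be summed over all
`j`, as the Lindblad form produces it. -/
theorem classicalGenerator_eq (β σ : ℝ) (E : Fin n → ℝ) (l m : Fin n) :
    classicalGenerator β σ E l m = alpha β σ (E l - E m) / n
      - if l = m then ∑ j, alpha β σ (E j - E m) / n else 0 := by
  unfold classicalGenerator
  by_cases h : l = m
  · subst h
    simp
  · simp [h]

theorem sum_classicalGenerator (β σ : ℝ) (E : Fin n → ℝ) (m : Fin n) :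
    ∑ l, classicalGenerator β σ E l m = 0 := by
  simp_rw [classicalGenerator_eq, Finset.sum_sub_distrib]
  simp

theorem classicalGenerator_pos {β σ : ℝ} (hβ : 0 < β) (hσ : 0 < σ) (E : Fin n → ℝ) {l m : Fin n}
    (h : l ≠ m) : 0 < classicalGenerator β σ E l m := by
  have hn : (0 : ℝ) < n := by exact_mod_cast l.pos
  rw [classicalGenerator_eq, if_neg h, sub_zero]
  exact div_pos (alpha_pos hβ hσ _) hn

theorem dephasingRate_pos {β σ : ℝ} (hβ : 0 < β) (hσ : 0 < σ) (E : Fin n → ℝ) (l m : Fin n) :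
    0 < dephasingRate β σ E l m := by
  have hn : (0 : ℝ) < n := by exact_mod_cast l.pos
  have : Nonempty (Fin n) := ⟨l⟩
  unfold dephasingRate
  refine mul_pos (by positivity) (Finset.sum_pos (fun j _ => ?_) Finset.univ_nonempty)
  exact add_pos (alpha_pos hβ hσ _) (alpha_pos hβ hσ _)

theorem classicalGenerator_mul_gibbs {β σ : ℝ} (hσ : 0 < σ) (E : Fin n → ℝ) (l m : Fin n) :
    classicalGenerator β σ E l m * gibbs β E m = classicalGenerator β σ E m l * gibbs β E l := by
  by_cases h : l = m
  · rw [h]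
  rw [classicalGenerator_eq, if_neg h, classicalGenerator_eq, if_neg (Ne.symm h), gibbs, gibbs,
    alpha_eq_exp_mul_alpha_neg hσ (E l - E m), neg_sub]
  have hexp : Real.exp (-(β * E l)) = Real.exp (-(β * (E l - E m))) * Real.exp (-(β * E m)) := by
    rw [← Real.exp_add]
    congr 1
    ring
  rw [hexp]
  ring

section Eigenbasis

variable {v : OrthonormalBasis (Fin n) ℂ (EuclideanSpace ℂ (Fin n))}

theorem anticomm_ketbra (m : Fin n) : anticomm (ketbra (v m) (v m))
    = ∑ k, (sandwich (ketbra (v m) (v m)) (ketbra (v k) (v k))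
      + sandwich (ketbra (v k) (v k)) (ketbra (v m) (v m))) := by
  ext1 N
  simp only [anticomm_apply, _root_.sum_apply, _root_.add_apply, sandwich_apply,
    Finset.sum_add_distrib, ← Finset.sum_mul, ← Finset.mul_sum, sum_ketbra_basis, one_mul, mul_one]

theorem averageLindbladian_eq {D : Measure (U n)} [IsProbabilityMeasure D]
    (hD : IsUnitaryOneDesign D) {H : Mat n} (hH : H.IsHermitian)
    {E : Fin n → ℝ} (hv : ∀ j, Matrix.toEuclideanLin H (v j) = (E j : ℂ) • v j) {β σ : ℝ}
    (hβ : 0 < β) (hσ : 0 < σ) :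
    averageLindbladian hH β σ D = classicalPart β σ E v + dephasingPart β σ E v := by
  rw [hD.averageLindbladian_eq_sum hH hv hβ hσ, Fintype.sum_prod_type]
  simp_rw [anticomm_ketbra]
  rw [sum_smul_sub_half_smul_sum (fun l m => (alpha β σ (E l - E m) / n : ℂ))
    (fun l m => sandwich (ketbra (v l) (v m)) (ketbra (v m) (v l)))
    (fun l m => sandwich (ketbra (v l) (v l)) (ketbra (v m) (v m))) fun _ => rfl,
    sub_eq_add_neg]
  unfold classicalPart dephasingPart
  congr 1
  · refine Finset.sum_congr rfl fun l _ => Finset.sum_congr rfl fun m _ => ?_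
    congr 1
    rw [classicalGenerator_eq]
    split_ifs <;> push_cast <;> rfl
  · congr 1
    refine Finset.sum_congr rfl fun l _ => Finset.sum_congr rfl fun m _ => ?_
    congr 1
    rw [dephasingRate]
    push_cast
    simp_rw [← add_div, ← Finset.sum_div]
    ring

end Eigenbasis

/-! ### Spectrum of the average -/

section Spectrum

variable (v : OrthonormalBasis (Fin n) ℂ (EuclideanSpace ℂ (Fin n)))

/-- The matrix element `⟨l|N|m⟩`, as a linear functional of `N`. -/
noncomputable def coord (l m : Fin n) : Mat n →ₗ[ℂ] ℂ :=
  Matrix.traceLinearMap (Fin n) ℂ ℂ ∘ₗ LinearMap.mulLeft ℂ (ketbra (v m) (v l))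

theorem coord_apply (l m : Fin n) (N : Mat n) :
    coord v l m N = (ketbra (v m) (v l) * N).trace := rfl

theorem coord_ketbra (l m a b : Fin n) :
    coord v l m (ketbra (v a) (v b)) = if l = a ∧ m = b then 1 else 0 := by
  rw [coord_apply, ketbra_basis_mul]
  by_cases h : l = a <;> simp [h, trace_ketbra_basis]

theorem sandwich_ketbra_apply (a b c d : Fin n) (N : Mat n) :
    sandwich (ketbra (v a) (v b)) (ketbra (v c) (v d)) N
      = coord v b c N • ketbra (v a) (v d) := by
  rw [sandwich_apply, ketbra_mul_mul_ketbra, coord_apply]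

theorem sum_coord_smul_ketbra (N : Mat n) :
    ∑ l, ∑ m, coord v l m N • ketbra (v l) (v m) = N := by
  simp_rw [← sandwich_ketbra_apply, sandwich_apply]
  exact sum_ketbra_mul_mul_ketbra v N

theorem coord_sum_smul_ketbra (x : Fin n → Fin n → ℂ) (l m : Fin n) :
    coord v l m (∑ a, ∑ b, x a b • ketbra (v a) (v b)) = x l m := by
  simp only [map_sum, map_smul, coord_ketbra, smul_eq_mul, mul_ite, mul_one, mul_zero, ite_and]
  simp

/-- Populations and coherences of a matrix. -/
noncomputable def blockCoord :
    Mat n ≃ₗ[ℂ] (Fin n → ℂ) × ({p : Fin n × Fin n // p.1 ≠ p.2} → ℂ) :=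
  LinearEquiv.ofBijective
    (LinearMap.prod (LinearMap.pi fun m => coord v m m)
      (LinearMap.pi fun p : {p : Fin n × Fin n // p.1 ≠ p.2} => coord v p.1.1 p.1.2)) <| by
    refine ⟨(injective_iff_map_eq_zero _).mpr fun N hN => ?_, fun ⟨x, y⟩ => ?_⟩
    · have hc : ∀ l m, coord v l m N = 0 := fun l m => by
        by_cases h : l = m
        · subst h
          exact congrFun (congrArg Prod.fst hN) l
        · exact congrFun (congrArg Prod.snd hN) ⟨(l, m), h⟩
      rw [← sum_coord_smul_ketbra v N]
      simp [hc]
    · refine ⟨∑ l, ∑ m, (if h : l = m then x l else y ⟨(l, m), h⟩) • ketbra (v l) (v m), ?_⟩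
      refine Prod.ext (funext fun m => ?_) (funext fun p => ?_)
      · exact (coord_sum_smul_ketbra v _ m m).trans (dif_pos rfl)
      · exact (coord_sum_smul_ketbra v _ p.1.1 p.1.2).trans (dif_neg p.2)

theorem blockCoord_apply (N : Mat n) :
    blockCoord v N = (fun m => coord v m m N, fun p => coord v p.1.1 p.1.2 N) := rfl

theorem coord_classicalPart (β σ : ℝ) (E : Fin n → ℝ) (l m : Fin n) (N : Mat n) :
    coord v l m (classicalPart β σ E v N)
      = if l = m then ∑ k, (classicalGenerator β σ E l k : ℂ) * coord v k k N else 0 := by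
  simp only [classicalPart, _root_.sum_apply, _root_.smul_apply, sandwich_ketbra_apply, map_sum,
    map_smul, coord_ketbra, smul_eq_mul]
  by_cases h : l = m
  · subst h
    rw [Finset.sum_eq_single l (fun b _ hb => by simp [hb.symm]) (by simp)]
    simp
  · rw [if_neg h]
    refine Finset.sum_eq_zero fun a _ => Finset.sum_eq_zero fun k _ => ?_
    rw [if_neg fun hh => h (hh.1.trans hh.2.symm), mul_zero, mul_zero]

theorem coord_dephasingPart (β σ : ℝ) (E : Fin n → ℝ) (l m : Fin n) (N : Mat n) :
    coord v l m (dephasingPart β σ E v N)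
      = if l = m then 0 else -(dephasingRate β σ E l m : ℂ) * coord v l m N := by
  simp only [dephasingPart, _root_.neg_apply, _root_.sum_apply, _root_.smul_apply,
    sandwich_ketbra_apply, map_neg, map_sum, map_smul, coord_ketbra, smul_eq_mul]
  rw [Finset.sum_eq_single l (fun b _ hb => by simp [hb.symm]) (by simp)]
  by_cases h : l = m
  · subst h
    rw [if_pos rfl, Finset.sum_eq_zero, neg_zero]
    intro k hk
    simp [(Finset.ne_of_mem_erase hk).symm]
  · rw [if_neg h, Finset.sum_eq_single m (fun k _ hk => by simp [hk.symm])
      (fun hm => absurd (Finset.mem_erase.mpr ⟨Ne.symm h, Finset.mem_univ m⟩) hm)]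
    simp

/-- Populations and coherences evolve independently, so the spectrum splits into that of `Q` and the
numbers `-κ_{lm}`. -/
theorem conj_blockCoord (β σ : ℝ) (E : Fin n → ℝ) :
    (blockCoord v).conj
        ((classicalPart β σ E v + dephasingPart β σ E v : Superop n) : Mat n →ₗ[ℂ] Mat n)
      = (Matrix.toLin' ((classicalGenerator β σ E).map ((↑) : ℝ → ℂ))).prodMap
          (Matrix.toLin' (Matrix.diagonal fun p : {p : Fin n × Fin n // p.1 ≠ p.2} =>
            (-(dephasingRate β σ E p.1.1 p.1.2) : ℂ))) := by
  refine LinearMap.ext fun z => ?_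
  obtain ⟨N, rfl⟩ := (blockCoord v).surjective z
  rw [LinearEquiv.conj_apply_apply, LinearEquiv.symm_apply_apply, blockCoord_apply,
    blockCoord_apply]
  refine Prod.ext (funext fun m => ?_) (funext fun p => ?_)
  · simp [coord_classicalPart, coord_dephasingPart, Matrix.mulVec, dotProduct]
  · simp [coord_classicalPart, coord_dephasingPart, p.2, Matrix.mulVec_diagonal]

open Polynomial in
theorem roots_charpoly_classicalPart_add_dephasingPart (β σ : ℝ) (E : Fin n → ℝ) :
    ((classicalPart β σ E v + dephasingPart β σ E v : Superop n) : Mat n →ₗ[ℂ] Mat n).charpoly.roots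
      = ((classicalGenerator β σ E).map ((↑) : ℝ → ℂ)).charpoly.roots
        + Finset.univ.val.map fun p : {p : Fin n × Fin n // p.1 ≠ p.2} =>
            (-(dephasingRate β σ E p.1.1 p.1.2) : ℂ) := by
  rw [← LinearEquiv.charpoly_conj (blockCoord v), conj_blockCoord, LinearMap.charpoly_prodMap,
    Matrix.charpoly_toLin', Matrix.charpoly_toLin', roots_mul
      (mul_ne_zero (Matrix.charpoly_monic _).ne_zero (Matrix.charpoly_monic _).ne_zero)]
  congr 1
  rw [Matrix.charpoly_diagonal]
  have h := roots_multiset_prod_X_sub_C (Finset.univ.val.map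
    fun p : {p : Fin n × Fin n // p.1 ≠ p.2} => (-(dephasingRate β σ E p.1.1 p.1.2) : ℂ))
  rw [Multiset.map_map] at h
  exact h

/-- The second claim keeps the infimum defining the gap off the empty set, where `sInf` defaults to
`0`. For `n = 1` no root would remain. -/
theorem zero_mem_roots_charpoly_classicalGenerator (β σ : ℝ) (E : Fin n → ℝ) (hn : 2 ≤ n) :
    0 ∈ ((classicalGenerator β σ E).map ((↑) : ℝ → ℂ)).charpoly.roots ∧
      ∃ z, z ∈ ((classicalGenerator β σ E).map ((↑) : ℝ → ℂ)).charpoly.roots.erase 0 := by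
  have : Nonempty (Fin n) := ⟨⟨0, by omega⟩⟩
  set Q := (classicalGenerator β σ E).map ((↑) : ℝ → ℂ) with hQ
  have h0 : (0 : ℂ) ∈ Q.charpoly.roots :=
    Q.zero_mem_roots_charpoly_of_sum_eq_zero fun m => by
      have := congrArg ((↑) : ℝ → ℂ) (sum_classicalGenerator β σ E m)
      simpa [hQ] using this
  refine ⟨h0, Multiset.card_pos_iff_exists_mem.mp ?_⟩
  rw [Multiset.card_erase_of_mem h0, IsAlgClosed.card_roots_eq_natDegree,
    Matrix.charpoly_natDegree_eq_dim, Fintype.card_fin]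
  exact Nat.sub_pos_of_lt hn

/-- The gap of the classical generator plus dephasing is the smaller of the two gaps. -/
theorem spectralGap_classicalPart_add_dephasingPart {β σ : ℝ} (hβ : 0 < β) (hσ : 0 < σ)
    (E : Fin n → ℝ) (hn : 2 ≤ n) :
    spectralGap ((classicalPart β σ E v + dephasingPart β σ E v : Superop n) : Mat n →ₗ[ℂ] Mat n)
      = min (spectralGap (Matrix.toLin' ((classicalGenerator β σ E).map ((↑) : ℝ → ℂ))))
          (⨅ p : {p : Fin n × Fin n // p.1 ≠ p.2}, dephasingRate β σ E p.1.1 p.1.2) := by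
  obtain ⟨h0, z₀, hz₀⟩ := zero_mem_roots_charpoly_classicalGenerator β σ E hn
  set Q := (classicalGenerator β σ E).map ((↑) : ℝ → ℂ) with hQ
  have hne : Nonempty {p : Fin n × Fin n // p.1 ≠ p.2} :=
    ⟨⟨(⟨0, by omega⟩, ⟨1, by omega⟩), by simp⟩⟩
  unfold spectralGap
  -- The removed `0` is taken from the classical roots, so the dephasing eigenvalues all remain.
  rw [roots_charpoly_classicalPart_add_dephasingPart, ← hQ, Multiset.erase_add_left_pos _ h0,
    Matrix.charpoly_toLin', iInf]
  have hset : {r : ℝ | ∃ z ∈ Q.charpoly.roots.erase 0 + Finset.univ.val.map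
      fun p : {p : Fin n × Fin n // p.1 ≠ p.2} => (-(dephasingRate β σ E p.1.1 p.1.2) : ℂ), r = ‖z‖}
      = {r : ℝ | ∃ z ∈ Q.charpoly.roots.erase 0, r = ‖z‖} ∪ Set.range
        fun p : {p : Fin n × Fin n // p.1 ≠ p.2} => dephasingRate β σ E p.1.1 p.1.2 := by
    ext r
    have hnorm : ∀ l m, ‖(-(dephasingRate β σ E l m) : ℂ)‖ = dephasingRate β σ E l m :=
      fun l m => by
        rw [norm_neg, Complex.norm_real, Real.norm_of_nonneg (dephasingRate_pos hβ hσ E l m).le]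
    simp only [Multiset.mem_add, Multiset.mem_map, Finset.mem_val, Finset.mem_univ, true_and,
      Set.mem_ofPred_eq, Set.mem_union, Set.mem_range, or_and_right, exists_or,
      exists_exists_eq_and, hnorm, eq_comm (a := r)]
  rw [hset]
  refine csInf_union ⟨0, ?_⟩ ⟨_, z₀, hz₀, rfl⟩ ⟨0, ?_⟩ (Set.range_nonempty _)
  · rintro r ⟨z, _, rfl⟩
    exact norm_nonneg z
  · rintro r ⟨p, rfl⟩
    exact (dephasingRate_pos hβ hσ E _ _).le

end Spectrum

end CKG
namespace CKG

variable {n : ℕ}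

/-! ### Lower bounds on the gap -/

/-- The gap is at least a constant times the proportion of low-energy states. -/
theorem mul_lowEnergyFraction_le_spectralGap {D : Measure (U n)} [IsProbabilityMeasure D]
    (hD : IsUnitaryOneDesign D) {H : Mat n} (hH : H.IsHermitian) {β σ K C : ℝ} (hβ : 0 < β)
    (hσ : 0 < σ) (hK : β * σ ≤ K) (hn : 2 ≤ n) :
    1 / 2 * Real.exp (-max (C + K ^ 2 / 2) 0) * lowEnergyFraction hH β C
      ≤ spectralGap (averageLindbladian hH β σ D : Mat n →ₗ[ℂ] Mat n) := by
  classical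
  set c := 1 / 2 * Real.exp (-max (C + K ^ 2 / 2) 0) with hc
  have hc0 : 0 ≤ c := by positivity
  have hn0 : (0 : ℝ) < n := by exact_mod_cast (by omega : 0 < n)
  set E := hH.eigenvalues with hE
  set S := Finset.univ.filter fun j => β * (E j - ⨅ k, E k) ≤ C with hS
  have hα : ∀ j ∈ S, ∀ m, c ≤ alpha β σ (E j - E m) := fun j hj m => by
    refine half_exp_le_alpha hβ hσ hK (le_trans ?_ (Finset.mem_filter.mp hj).2)
    have := ciInf_le (Set.finite_range E).bddBelow m
    gcongr
  have hfrac : lowEnergyFraction hH β C = (S.card : ℝ) / n := by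
    rw [lowEnergyFraction, Nat.card_eq_fintype_card, Fintype.card_subtype]
  have hv := toEuclideanLin_eigenvectorBasis hH
  rw [averageLindbladian_eq hD hH hv hβ hσ,
    spectralGap_classicalPart_add_dephasingPart _ hβ hσ _ hn, hfrac]
  have hne : Nonempty {p : Fin n × Fin n // p.1 ≠ p.2} :=
    ⟨⟨(⟨0, by omega⟩, ⟨1, by omega⟩), by simp⟩⟩
  refine le_min ?_ (le_ciInf fun p => ?_)
  · rw [spectralGap, Matrix.charpoly_toLin']
    obtain ⟨z₀, hz₀⟩ := (zero_mem_roots_charpoly_classicalGenerator β σ E hn).2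
    refine le_csInf ⟨_, z₀, hz₀, rfl⟩ ?_
    rintro _ ⟨z, hz, rfl⟩
    -- Doeblin bound with rate `c / n` into each low-energy state and `0` into the others; the total
    -- is `c |S| / n`.
    refine le_trans (le_of_eq ?_) (Matrix.sum_le_norm_of_mem_roots_charpoly_erase _
      (fun l => if l ∈ S then c / n else 0) (sum_classicalGenerator β σ E) (fun l m hlm => ?_) hz)
    · simp only [Finset.sum_ite_mem, Finset.univ_inter, Finset.sum_const, nsmul_eq_mul]
      ring
    · split_ifs with hl
      · rw [classicalGenerator_eq, if_neg hlm, sub_zero]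
        have := hα l hl m
        gcongr
      · exact (classicalGenerator_pos hβ hσ E hlm).le
  -- Each low-energy `j` contributes at least `c` from both `l` and `m`; the `2` cancels against `1
  -- / (2n)`.
  · have hsum : ∑ j, (if j ∈ S then 2 * c else 0)
        ≤ ∑ j, (alpha β σ (E j - E p.1.1) + alpha β σ (E j - E p.1.2)) :=
      Finset.sum_le_sum fun j _ => by
        split_ifs with hj
        · linarith [hα j hj p.1.1, hα j hj p.1.2]
        · exact (add_pos (alpha_pos hβ hσ _) (alpha_pos hβ hσ _)).le
    simp only [Finset.sum_ite_mem, Finset.univ_inter, Finset.sum_const, nsmul_eq_mul] at hsum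
    calc c * (S.card / n) = 1 / (2 * n) * (S.card * (2 * c)) := by field_simp
      _ ≤ _ := by
        unfold dephasingRate
        gcongr

theorem abs_eigenvalues_le_norm {H : Mat n} (hH : H.IsHermitian) (j : Fin n) :
    |hH.eigenvalues j| ≤ ‖H‖ := by
  have h := Matrix.l2_opNorm_mulVec H (hH.eigenvectorBasis j)
  have h2 := congrArg norm (toEuclideanLin_eigenvectorBasis hH j)
  rw [norm_smul, hH.eigenvectorBasis.norm_eq_one, mul_one, Complex.norm_real, Real.norm_eq_abs]
    at h2
  rw [hH.eigenvectorBasis.norm_eq_one, mul_one] at h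
  exact h2.symm.trans_le h

/-- The spectrum lies in `[-‖H‖, ‖H‖]`, so its width is at most `2‖H‖`. -/
theorem lowEnergyFraction_eq_one {H : Mat n} (hH : H.IsHermitian) {β C : ℝ} (hβ : 0 < β)
    (hn : 0 < n) (hC : 2 * (β * ‖H‖) ≤ C) : lowEnergyFraction hH β C = 1 := by
  have : Nonempty (Fin n) := ⟨⟨0, hn⟩⟩
  have hall : ∀ j, β * (hH.eigenvalues j - ⨅ k, hH.eigenvalues k) ≤ C := fun j => by
    have h1 : -‖H‖ ≤ ⨅ k, hH.eigenvalues k :=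
      le_ciInf fun k => (abs_le.mp (abs_eigenvalues_le_norm hH k)).1
    have h2 := (abs_le.mp (abs_eigenvalues_le_norm hH j)).2
    refine le_trans ?_ hC
    nlinarith
  have hn0 : (n : ℝ) ≠ 0 := by exact_mod_cast hn.ne'
  rw [lowEnergyFraction, Nat.card_congr (Equiv.subtypeUnivEquiv hall), Nat.card_fin, div_self hn0]

theorem lowEnergyFraction_nonneg {H : Mat n} (hH : H.IsHermitian) (β C : ℝ) :
    0 ≤ lowEnergyFraction hH β C := by
  unfold lowEnergyFraction; positivity

theorem lowEnergyFraction_isBigO_spectralGap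
    {H : ∀ n : ℕ, Mat n} (hH : ∀ n, (H n).IsHermitian) {β σ : ℕ → ℝ} (hβ : ∀ n, 0 < β n)
    (hσ : ∀ n, 0 < σ n) (hσβ : σ =O[atTop] fun n => (β n)⁻¹)
    {D : ∀ n : ℕ, Measure (U n)} (hD : ∀ n, IsProbabilityMeasure (D n))
    (hdesign : ∀ n, IsUnitaryOneDesign (D n)) (C : ℝ) :
    (fun n => lowEnergyFraction (hH n) (β n) C) =O[atTop]
      fun n => spectralGap (averageLindbladian (hH n) (β n) (σ n) (D n) : Mat n →ₗ[ℂ] Mat n) := by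
  obtain ⟨K, hK⟩ := hσβ.bound
  set c := 1 / 2 * Real.exp (-max (C + K ^ 2 / 2) 0) with hc
  have hc0 : 0 < c := by positivity
  refine IsBigO.of_bound c⁻¹ ?_
  filter_upwards [hK, eventually_ge_atTop 2] with n hKn hn
  have := hD n
  -- The bound `σ ≤ K β⁻¹` supplies the constant `K` of the uniform estimate.
  have hβσ : β n * σ n ≤ K := by
    rw [Real.norm_of_nonneg (hσ n).le, Real.norm_of_nonneg (inv_pos.mpr (hβ n)).le,
      ← div_eq_mul_inv, le_div_iff₀ (hβ n)] at hKn
    linarith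
  have h := mul_lowEnergyFraction_le_spectralGap (hdesign n) (hH n) (C := C) (hβ n) (hσ n) hβσ hn
  rw [← hc] at h
  have h0 := lowEnergyFraction_nonneg (hH n) (β n) C
  rw [Real.norm_of_nonneg h0, Real.norm_of_nonneg ((mul_nonneg hc0.le h0).trans h),
    ← div_eq_inv_mul, le_div_iff₀ hc0, mul_comm]
  exact h

end CKG

theorem mainTheorem4
    (H : ∀ n : ℕ, CKG.Mat n) (hH : ∀ n, (H n).IsHermitian)
    (β σ : ℕ → ℝ) (hβ : ∀ n, 0 < β n) (hσ : ∀ n, 0 < σ n)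
    (hσβ : σ =Θ[atTop] fun n => (β n)⁻¹)
    (D : ∀ n : ℕ, Measure (CKG.U n)) (hD : ∀ n, IsProbabilityMeasure (D n))
    (hdesign : ∀ n, CKG.IsUnitaryOneDesign (D n)) :
    -- the expectation exists
    (∀ n, Integrable (fun V : CKG.U n => CKG.jumpLindbladian (hH n) (β n) (σ n) V) (D n)) ∧
    -- in every energy eigenbasis it splits into a classical and a dephasing part
    (∀ n, ∀ (v : OrthonormalBasis (Fin n) ℂ (EuclideanSpace ℂ (Fin n))) (E : Fin n → ℝ),
      (∀ j, Matrix.toEuclideanLin (H n) (v j) = (E j : ℂ) • v j) →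
        CKG.averageLindbladian (hH n) (β n) (σ n) (D n)
            = CKG.classicalPart (β n) (σ n) E v + CKG.dephasingPart (β n) (σ n) E v ∧
        -- the classical part is a Markov generator, reversible for the Gibbs distribution
        (∀ l m, l ≠ m → 0 < CKG.classicalGenerator (β n) (σ n) E l m) ∧
        (∀ m, ∑ l, CKG.classicalGenerator (β n) (σ n) E l m = 0) ∧
        (∀ l m, CKG.classicalGenerator (β n) (σ n) E l m * CKG.gibbs (β n) E m
            = CKG.classicalGenerator (β n) (σ n) E m l * CKG.gibbs (β n) E l) ∧
        -- every coherence is damped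
        (∀ l m, l ≠ m → 0 < CKG.dephasingRate (β n) (σ n) E l m) ∧
        -- the gap is the smaller of the two gaps
        (2 ≤ n →
          CKG.spectralGap
              (CKG.averageLindbladian (hH n) (β n) (σ n) (D n) : CKG.Mat n →ₗ[ℂ] CKG.Mat n)
            = min
                (CKG.spectralGap (Matrix.toLin'
                  ((CKG.classicalGenerator (β n) (σ n) E).map ((↑) : ℝ → ℂ))))
                (⨅ p : {p : Fin n × Fin n // p.1 ≠ p.2},
                  CKG.dephasingRate (β n) (σ n) E p.1.1 p.1.2))) ∧
    -- the gap is `Ω(δ(n))`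
    (∀ C : ℝ,
      (fun n => CKG.lowEnergyFraction (hH n) (β n) C) =O[atTop]
        (fun n => CKG.spectralGap
          (CKG.averageLindbladian (hH n) (β n) (σ n) (D n) : CKG.Mat n →ₗ[ℂ] CKG.Mat n))) ∧
    -- the gap is `Ω(1)` for bounded degree systems
    ((fun n => β n * ‖H n‖) =O[atTop] (fun _ => (1 : ℝ)) →
      (fun _ => (1 : ℝ)) =O[atTop]
        (fun n => CKG.spectralGap
          (CKG.averageLindbladian (hH n) (β n) (σ n) (D n) : CKG.Mat n →ₗ[ℂ] CKG.Mat n))) := by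

  refine ⟨fun n => ?_, fun n v E hv => ⟨?_, ?_, ?_, ?_, ?_, fun hn => ?_⟩, fun C => ?_, fun hbd => ?_⟩
  · have := hD n
    exact CKG.integrable_of_continuous (E := CKG.Superop n) (D n)
      (CKG.continuous_jumpLindbladian (hH n) (hβ n) (hσ n))
  · have := hD n
    exact CKG.averageLindbladian_eq (hdesign n) (hH n) hv (hβ n) (hσ n)
  · exact fun l m h => CKG.classicalGenerator_pos (hβ n) (hσ n) E h
  · exact CKG.sum_classicalGenerator (β n) (σ n) E
  · exact CKG.classicalGenerator_mul_gibbs (hσ n) E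
  · exact fun l m _ => CKG.dephasingRate_pos (hβ n) (hσ n) E l m
  · have := hD n
    rw [CKG.averageLindbladian_eq (hdesign n) (hH n) hv (hβ n) (hσ n)]
    exact CKG.spectralGap_classicalPart_add_dephasingPart v (hβ n) (hσ n) E hn
  · exact CKG.lowEnergyFraction_isBigO_spectralGap hH hβ hσ hσβ.1 hD hdesign C
  · obtain ⟨K, hK⟩ := hbd.bound
    -- With `β‖H‖ ≤ K`, the cutoff `2 * K` admits every eigenvalue, so the proportion is eventually
    -- `1`.
    refine IsBigO.trans (IsBigO.of_bound 1 ?_)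
      (CKG.lowEnergyFraction_isBigO_spectralGap hH hβ hσ hσβ.1 hD hdesign (2 * K))
    filter_upwards [hK, eventually_ge_atTop 1] with n hKn hn
    rw [Real.norm_of_nonneg (mul_nonneg (hβ n).le (norm_nonneg _)), norm_one, mul_one] at hKn
    rw [CKG.lowEnergyFraction_eq_one (hH n) (hβ n) hn (by linarith)]
    simp
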